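/- Let $\mathbb{K}$ be a field of characteristic zero, $q$ an indeterminate, and let $U=U_q(\mathfrak{sl}_2\times\mathfrak{sl}_2)$ be the quantised enveloping algebra over $\mathbb{K}(q)$ with generators $E_i,F_i,K_i^{\pm1}$ ($i=1,2$), subject to the relations that the $K_i$ commute, $K_iE_jK_i^{-1}=q^{2\delta_{ij}}E_j$, $K_iF_jK_i^{-1}=q^{-2\delta_{ij}}F_j$, $E_iF_j-F_jE_i=\delta_{ij}\frac{K_i-K_i^{-1}}{q-q^{-1}}$, $E_1E_2=E_2E_1$ and $F_1F_2=F_2F_1$. Let $u\mapsto\overline{u}$ be the bar involution of $U$, that is, the $\mathbb{K}$-algebra automorphism with $\overline{q}=q^{-1}$, $\overline{E_i}=E_i$, $\overline{F_i}=F_i$, $\overline{K_i}=K_i^{-1}$. Let $U^+$ be the subalgebra generated by $E_1,E_2$, with weight spaces $U^+_\mu$ for $\mu\in Q^+=\mathbb{N}_0\alpha_1\oplus\mathbb{N}_0\alpha_2$. Let $\mathscr{U}$ be the algebra of natural endomorphisms of the forgetful functor from finite-dimensional $U$-modules of type $1$ to $\mathbb{K}(q)$-vector spaces; both $U$ and $\prod_{\mu\in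 Q^+}U^+_\mu$ act on these modules and so map to $\mathscr{U}$. Consider the Satake diagram of type $AIII_{11}$: two unconnected white nodes $1,2$, no black nodes, and the diagram automorphism $\tau$ that interchanges $1$ and $2$; put $\Theta(\alpha_i)=-\alpha_{\tau(i)}$ and $s(1)=s(2)=1$, $\mathbf{s}=(0,0)$. Let $c_1,c_2\in\mathbb{K}(q)^\times$ satisfy $c_1=c_2$ and $c_{\tau(i)}=\overline{c_i}$ for $i=1,2$. Let $B_{\mathbf c}\subset U$ be the $\mathbb{K}(q)$-subalgebra generated by $U^0_\Theta=\langle K_\lambda\mid\lambda\in Q,\ \Theta(\lambda)=\lambda\rangle$ and $B_i=F_i-c_iE_{\tau(i)}K_i^{-1}$ for $i=1,2$. Then there is a unique $\mathbb{K}$-algebra automorphism $b\mapsto\overline{b}^B$ of $B_{\mathbf c}$ that agrees with the bar involution of $U$ on $U^0_\Theta$ and fixes $B_1$ and $B_2$. There is a unique element $\mathfrak{X}=\sum_{\mu\in Q^+}\mathfrak{X}_\mu\in\prod_{\mu\in Q^+}U^+_\mu$ (the quasi $K$-matrix) with $\mathfrak{X}_0=1$ such that $\overline{b}^B\,\mathfrak{X}=\mathfrak{X}\,\overline{b}$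 holds in $\mathscr{U}$ for all $b\in B_{\mathbf c}$. It is given by $$\mathfrak{X}=\sum_{n\ge0}\frac{(q-q^{-1})^n}{\{n\}!}\,c_1^n\,(E_1E_2)^n,$$ where $\{k\}=1+q^2+\dots+q^{2(k-1)}$ and $\{n\}!=\prod_{k=1}^n\{k\}$. -/

import Mathlib

/-! Quantum symmetric pair of type `AIII₁₁`: the Lie algebra is `sl₂ × sl₂` with Dynkin diagram
two unconnected nodes (indexed by `Fin 2`), no black nodes, and `τ` the swap of the two nodes. -/

universe u

noncomputable section

namespace AIII11

open Polynomial

/-! ### The ground field `𝕂(q)` -/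

/-- The indeterminate `q` of the field `𝕂(q)` of rational functions. -/
abbrev q (𝕂 : Type u) [Field 𝕂] : RatFunc 𝕂 := RatFunc.X

lemma q_ne_zero (𝕂 : Type u) [Field 𝕂] : q 𝕂 ≠ 0 := RatFunc.X_ne_zero

lemma q_pow_ne_one (𝕂 : Type u) [Field 𝕂] {n : ℕ} (hn : n ≠ 0) : q 𝕂 ^ n ≠ 1 := by
  intro h
  have h1 : (algebraMap 𝕂[X] (RatFunc 𝕂)) (X ^ n) = algebraMap 𝕂[X] (RatFunc 𝕂) 1 := by
    rw [map_pow, RatFunc.algebraMap_X, map_one]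
    exact h
  have h2 : (X ^ n : 𝕂[X]) = 1 := RatFunc.algebraMap_injective 𝕂 h1
  have h3 := congrArg natDegree h2
  rw [natDegree_X_pow, natDegree_one] at h3
  exact hn h3

lemma q_zpow_injective (𝕂 : Type u) [Field 𝕂] : Function.Injective (fun n : ℤ => q 𝕂 ^ n) := by
  have key : ∀ n : ℤ, q 𝕂 ^ n = 1 → n = 0 := by
    intro n hn
    by_contra h0
    rcases Int.natAbs_eq n with h | h
    · rw [h, zpow_natCast] at hn
      exact q_pow_ne_one 𝕂 (Int.natAbs_ne_zero.2 h0) hn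
    · rw [h, zpow_neg, zpow_natCast, inv_eq_one] at hn
      exact q_pow_ne_one 𝕂 (Int.natAbs_ne_zero.2 h0) hn
  intro m n h
  have h' : q 𝕂 ^ m = q 𝕂 ^ n := h
  have : q 𝕂 ^ (m - n) = 1 := by
    rw [zpow_sub₀ (q_ne_zero 𝕂), h', div_self (zpow_ne_zero _ (q_ne_zero 𝕂))]
  have := key _ this
  omega

lemma aeval_q_inv_injective (𝕂 : Type u) [Field 𝕂] :
    Function.Injective (aeval (R := 𝕂) (q 𝕂)⁻¹) := by
  have h : Transcendental 𝕂 (q 𝕂) := by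
    rw [transcendental_iff]
    intro p hp
    rw [RatFunc.aeval_X_left_eq_algebraMap] at hp
    exact RatFunc.algebraMap_injective 𝕂 (by rw [hp, map_zero])
  have h' : Transcendental 𝕂 (q 𝕂)⁻¹ := fun ha => h (by simpa using ha.inv)
  exact transcendental_iff_injective.1 h'

/-- The bar involution `f(q) ↦ f(q⁻¹)` of `𝕂(q)`. -/
def barQ (𝕂 : Type u) [Field 𝕂] : RatFunc 𝕂 →ₐ[𝕂] RatFunc 𝕂 :=
  RatFunc.liftAlgHom (aeval (q 𝕂)⁻¹)
    (nonZeroDivisors_le_comap_nonZeroDivisors_of_injective _ (aeval_q_inv_injective 𝕂))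

@[simp] lemma barQ_q (𝕂 : Type u) [Field 𝕂] : barQ 𝕂 (q 𝕂) = (q 𝕂)⁻¹ := by
  have h : ∀ p : 𝕂[X], barQ 𝕂 (algebraMap 𝕂[X] (RatFunc 𝕂) p) = aeval (q 𝕂)⁻¹ p := by
    intro p
    have := RatFunc.liftAlgHom_apply_div' (aeval (R := 𝕂) (q 𝕂)⁻¹)
      (nonZeroDivisors_le_comap_nonZeroDivisors_of_injective _ (aeval_q_inv_injective 𝕂)) p 1
    simpa [barQ] using this
  simpa using h X

/-! ### The quantised enveloping algebra -/

/-- The Cartan matrix of `sl₂ × sl₂`; it is also the matrix of the form `(αᵢ, αⱼ)`. -/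
def cartan (i j : Fin 2) : ℤ := if i = j then 2 else 0

/-- Generators `Eᵢ, Fᵢ, Kᵢ, Kᵢ⁻¹`. -/
inductive Gen : Type
  | E (i : Fin 2)
  | F (i : Fin 2)
  | K (i : Fin 2)
  | Kinv (i : Fin 2)

/-- The free algebra on the generators. -/
abbrev Free (𝕂 : Type u) [Field 𝕂] : Type u := FreeAlgebra (RatFunc 𝕂) Gen

/-- The generator `g` in the free algebra. -/
abbrev gen (𝕂 : Type u) [Field 𝕂] (g : Gen) : Free 𝕂 := FreeAlgebra.ι (RatFunc 𝕂) g

open Gen in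
/-- The defining relations of `U_q(sl₂ × sl₂)`. The quantum Serre relations for a pair `i ≠ j` with
`a_{ij} = 0` say that `Eᵢ, Eⱼ` commute and that `Fᵢ, Fⱼ` commute. -/
inductive Rel (𝕂 : Type u) [Field 𝕂] : Free 𝕂 → Free 𝕂 → Prop
  | K_mul_Kinv (i : Fin 2) : Rel 𝕂 (gen 𝕂 (K i) * gen 𝕂 (Kinv i)) 1
  | Kinv_mul_K (i : Fin 2) : Rel 𝕂 (gen 𝕂 (Kinv i) * gen 𝕂 (K i)) 1
  | K_comm (i j : Fin 2) : Rel 𝕂 (gen 𝕂 (K i) * gen 𝕂 (K j)) (gen 𝕂 (K j) * gen 𝕂 (K i))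
  | K_E (i j : Fin 2) : Rel 𝕂 (gen 𝕂 (K i) * gen 𝕂 (E j) * gen 𝕂 (Kinv i))
      (q 𝕂 ^ cartan i j • gen 𝕂 (E j))
  | K_F (i j : Fin 2) : Rel 𝕂 (gen 𝕂 (K i) * gen 𝕂 (F j) * gen 𝕂 (Kinv i))
      (q 𝕂 ^ (-cartan i j) • gen 𝕂 (F j))
  | E_F_same (i : Fin 2) : Rel 𝕂 (gen 𝕂 (E i) * gen 𝕂 (F i) - gen 𝕂 (F i) * gen 𝕂 (E i))
      ((q 𝕂 - (q 𝕂)⁻¹)⁻¹ • (gen 𝕂 (K i) - gen 𝕂 (Kinv i)))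
  | E_F_ne (i j : Fin 2) (h : i ≠ j) :
      Rel 𝕂 (gen 𝕂 (E i) * gen 𝕂 (F j) - gen 𝕂 (F j) * gen 𝕂 (E i)) 0
  | serre_E (i j : Fin 2) (h : i ≠ j) :
      Rel 𝕂 (gen 𝕂 (E i) * gen 𝕂 (E j) - gen 𝕂 (E j) * gen 𝕂 (E i)) 0
  | serre_F (i j : Fin 2) (h : i ≠ j) :
      Rel 𝕂 (gen 𝕂 (F i) * gen 𝕂 (F j) - gen 𝕂 (F j) * gen 𝕂 (F i)) 0

/-- The quantised enveloping algebra `U = U_q(sl₂ × sl₂)` over `𝕂(q)`. -/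
def U (𝕂 : Type u) [Field 𝕂] : Type u := RingQuot (Rel 𝕂)

instance (𝕂 : Type u) [Field 𝕂] : Ring (U 𝕂) := inferInstanceAs (Ring (RingQuot (Rel 𝕂)))

instance (𝕂 : Type u) [Field 𝕂] : Algebra (RatFunc 𝕂) (U 𝕂) :=
  inferInstanceAs (Algebra (RatFunc 𝕂) (RingQuot (Rel 𝕂)))

instance (𝕂 : Type u) [Field 𝕂] : Algebra 𝕂 (U 𝕂) :=
  Algebra.compHom (U 𝕂) (algebraMap 𝕂 (RatFunc 𝕂))

instance (𝕂 : Type u) [Field 𝕂] : IsScalarTower 𝕂 (RatFunc 𝕂) (U 𝕂) :=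
  IsScalarTower.of_algebraMap_eq fun _ => rfl

/-- The projection from the free algebra to `U`. -/
def proj (𝕂 : Type u) [Field 𝕂] : Free 𝕂 →ₐ[RatFunc 𝕂] U 𝕂 :=
  RingQuot.mkAlgHom (RatFunc 𝕂) (Rel 𝕂)

lemma proj_rel (𝕂 : Type u) [Field 𝕂] {x y : Free 𝕂} (h : Rel 𝕂 x y) :
    proj 𝕂 x = proj 𝕂 y :=
  RingQuot.mkAlgHom_rel _ h

/-- The universal property of `U`. -/
def liftU (𝕂 : Type u) [Field 𝕂] {A : Type*} [Ring A] [Algebra (RatFunc 𝕂) A]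
    (f : Free 𝕂 →ₐ[RatFunc 𝕂] A) (hf : ∀ ⦃x y⦄, Rel 𝕂 x y → f x = f y) :
    U 𝕂 →ₐ[RatFunc 𝕂] A :=
  RingQuot.liftAlgHom (RatFunc 𝕂) ⟨f, hf⟩

lemma liftU_proj (𝕂 : Type u) [Field 𝕂] {A : Type*} [Ring A] [Algebra (RatFunc 𝕂) A]
    (f : Free 𝕂 →ₐ[RatFunc 𝕂] A) (hf : ∀ ⦃x y⦄, Rel 𝕂 x y → f x = f y) (x : Free 𝕂) :
    liftU 𝕂 f hf (proj 𝕂 x) = f x :=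
  RingQuot.liftAlgHom_mkAlgHom_apply (RatFunc 𝕂) f hf x

/-- The image of a generator in `U`. -/
def ofGen (𝕂 : Type u) [Field 𝕂] (g : Gen) : U 𝕂 := proj 𝕂 (gen 𝕂 g)

/-- `Eᵢ` -/
abbrev E (𝕂 : Type u) [Field 𝕂] (i : Fin 2) : U 𝕂 := ofGen 𝕂 (Gen.E i)

/-- `Fᵢ` -/
abbrev F (𝕂 : Type u) [Field 𝕂] (i : Fin 2) : U 𝕂 := ofGen 𝕂 (Gen.F i)

/-- The invertible element `Kᵢ`, whose inverse is the generator `Kᵢ⁻¹`. -/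
def K (𝕂 : Type u) [Field 𝕂] (i : Fin 2) : (U 𝕂)ˣ where
  val := ofGen 𝕂 (Gen.K i)
  inv := ofGen 𝕂 (Gen.Kinv i)
  val_inv := by
    rw [ofGen, ofGen, ← map_mul, proj_rel 𝕂 (Rel.K_mul_Kinv i), map_one]
  inv_val := by
    rw [ofGen, ofGen, ← map_mul, proj_rel 𝕂 (Rel.Kinv_mul_K i), map_one]

/-- `K_λ = K₁^{n₁} K₂^{n₂}` for `λ = n₁ α₁ + n₂ α₂` in the root lattice. -/
def Kroot (𝕂 : Type u) [Field 𝕂] (l : Fin 2 → ℤ) : (U 𝕂)ˣ := K 𝕂 0 ^ l 0 * K 𝕂 1 ^ l 1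

/-! ### The bar involution of `U` -/

/-- `U` with the scalars acting through `q ↦ q⁻¹`; only used to construct `barU`. -/
def TwistedU (𝕂 : Type u) [Field 𝕂] : Type u := U 𝕂

instance (𝕂 : Type u) [Field 𝕂] : Ring (TwistedU 𝕂) := inferInstanceAs (Ring (U 𝕂))

/-- The twisted algebra structure. -/
instance (𝕂 : Type u) [Field 𝕂] : Algebra (RatFunc 𝕂) (TwistedU 𝕂) :=
  RingHom.toAlgebra' (R := RatFunc 𝕂) (S := TwistedU 𝕂)
    ((algebraMap (RatFunc 𝕂) (U 𝕂)).comp (barQ 𝕂).toRingHom)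
    (fun r x => Algebra.commutes (A := U 𝕂) (barQ 𝕂 r) x)

/-- The identity map, as a ring isomorphism. -/
def toTwisted (𝕂 : Type u) [Field 𝕂] : U 𝕂 ≃+* TwistedU 𝕂 := RingEquiv.refl (U 𝕂)

/-- The images of the generators under the bar involution: `Eᵢ ↦ Eᵢ`, `Fᵢ ↦ Fᵢ`,
`Kᵢ ↦ Kᵢ⁻¹`. -/
def barGen : Gen → Gen
  | .E i => .E i
  | .F i => .F i
  | .K i => .Kinv i
  | .Kinv i => .K i

/-- The bar involution on the free algebra, followed by the projection to `U`. -/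
def barFree (𝕂 : Type u) [Field 𝕂] : Free 𝕂 →ₐ[RatFunc 𝕂] TwistedU 𝕂 :=
  FreeAlgebra.lift (RatFunc 𝕂) (fun g => toTwisted 𝕂 (ofGen 𝕂 (barGen g)))

lemma twisted_smul (𝕂 : Type u) [Field 𝕂] (r : RatFunc 𝕂) (x : U 𝕂) :
    r • toTwisted 𝕂 x = toTwisted 𝕂 (barQ 𝕂 r • x) := by
  rw [Algebra.smul_def, Algebra.smul_def, map_mul]
  rfl

lemma barFree_rel (𝕂 : Type u) [Field 𝕂] ⦃x y : Free 𝕂⦄ (h : Rel 𝕂 x y) :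
    barFree 𝕂 x = barFree 𝕂 y := by
  have hg : ∀ g : Gen, barFree 𝕂 (gen 𝕂 g) = toTwisted 𝕂 (ofGen 𝕂 (barGen g)) := fun g =>
    FreeAlgebra.lift_ι_apply _ _
  have K1 : ∀ i, ofGen 𝕂 (.K i) * ofGen 𝕂 (.Kinv i) = 1 := fun i => (K 𝕂 i).val_inv
  have K2 : ∀ i, ofGen 𝕂 (.Kinv i) * ofGen 𝕂 (.K i) = 1 := fun i => (K 𝕂 i).inv_val
  have key : ∀ (x : U 𝕂) (n : ℤ) (i : Fin 2),
      ofGen 𝕂 (.K i) * x * ofGen 𝕂 (.Kinv i) = q 𝕂 ^ n • x →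
      ofGen 𝕂 (.Kinv i) * x * ofGen 𝕂 (.K i) = (q 𝕂)⁻¹ ^ n • x := by
    intro x n i hx
    have : ofGen 𝕂 (.Kinv i) * (q 𝕂 ^ n • x) * ofGen 𝕂 (.K i) = x := by
      rw [← hx]
      calc _ = (ofGen 𝕂 (.Kinv i) * ofGen 𝕂 (.K i)) * x *
            (ofGen 𝕂 (.Kinv i) * ofGen 𝕂 (.K i)) := by noncomm_ring
        _ = x := by rw [K2, one_mul, mul_one]
    rw [mul_smul_comm, smul_mul_assoc] at this
    rw [← this, smul_smul, inv_zpow, inv_mul_cancel₀ (zpow_ne_zero _ (q_ne_zero 𝕂)), one_smul,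
      this]
  cases h with
  | K_mul_Kinv i =>
    simp only [map_mul, map_one, hg, barGen]
    rw [← map_mul, K2, map_one]
  | Kinv_mul_K i =>
    simp only [map_mul, map_one, hg, barGen]
    rw [← map_mul, K1, map_one]
  | K_comm i j =>
    simp only [map_mul, hg, barGen]
    have h : K 𝕂 i * K 𝕂 j = K 𝕂 j * K 𝕂 i := by
      ext
      have := proj_rel 𝕂 (Rel.K_comm i j)
      rw [map_mul, map_mul] at this
      exact this
    have h' := congrArg (fun u : (U 𝕂)ˣ => ((u⁻¹ : (U 𝕂)ˣ) : U 𝕂)) h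
    simp only [mul_inv_rev, Units.val_mul] at h'
    rw [← map_mul, ← map_mul]
    exact congrArg _ h'.symm
  | K_E i j =>
    have := proj_rel 𝕂 (Rel.K_E i j)
    simp only [map_mul, map_smul] at this
    simp only [map_mul, map_smul, hg, barGen, twisted_smul, map_zpow₀, barQ_q]
    rw [← map_mul, ← map_mul]
    exact congrArg (toTwisted 𝕂) (key _ _ _ this)
  | K_F i j =>
    have := proj_rel 𝕂 (Rel.K_F i j)
    simp only [map_mul, map_smul] at this
    simp only [map_mul, map_smul, hg, barGen, twisted_smul, map_zpow₀, barQ_q]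
    rw [← map_mul, ← map_mul]
    exact congrArg (toTwisted 𝕂) (key _ _ _ this)
  | E_F_same i =>
    have := proj_rel 𝕂 (Rel.E_F_same i)
    simp only [map_mul, map_sub, map_smul] at this
    simp only [map_mul, map_sub, map_smul, hg, barGen]
    simp only [← map_mul, ← map_sub]
    rw [twisted_smul, map_inv₀, map_sub (barQ 𝕂), map_inv₀, barQ_q, inv_inv]
    refine congrArg _ (Eq.trans this ?_)
    rw [← neg_sub (q 𝕂) (q 𝕂)⁻¹, inv_neg, neg_smul, ← smul_neg, neg_sub]
    rfl
  | E_F_ne i j hij =>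
    have := proj_rel 𝕂 (Rel.E_F_ne i j hij)
    simp only [map_mul, map_sub, map_zero] at this
    simp only [map_mul, map_sub, map_zero, hg, barGen]
    simp only [← map_mul, ← map_sub]
    exact (congrArg (toTwisted 𝕂) this).trans (map_zero _)
  | serre_E i j hij =>
    have := proj_rel 𝕂 (Rel.serre_E i j hij)
    simp only [map_mul, map_sub, map_zero] at this
    simp only [map_mul, map_sub, map_zero, hg, barGen]
    simp only [← map_mul, ← map_sub]
    exact (congrArg (toTwisted 𝕂) this).trans (map_zero _)
  | serre_F i j hij =>
    have := proj_rel 𝕂 (Rel.serre_F i j hij)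
    simp only [map_mul, map_sub, map_zero] at this
    simp only [map_mul, map_sub, map_zero, hg, barGen]
    simp only [← map_mul, ← map_sub]
    exact (congrArg (toTwisted 𝕂) this).trans (map_zero _)

/-- The induced algebra homomorphism out of `U`. -/
def barTwisted (𝕂 : Type u) [Field 𝕂] : U 𝕂 →ₐ[RatFunc 𝕂] TwistedU 𝕂 :=
  liftU 𝕂 (barFree 𝕂) (barFree_rel 𝕂)

/-- The bar involution of `U`, the ring homomorphism with `f ↦ barQ f` on scalars, `Eᵢ ↦ Eᵢ`,
`Fᵢ ↦ Fᵢ`, `Kᵢ ↦ Kᵢ⁻¹`. -/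
def barU (𝕂 : Type u) [Field 𝕂] : U 𝕂 →+* U 𝕂 :=
  ((toTwisted 𝕂).symm : TwistedU 𝕂 →+* U 𝕂).comp (barTwisted 𝕂 : U 𝕂 →+* TwistedU 𝕂)

@[simp] lemma barU_algebraMap (𝕂 : Type u) [Field 𝕂] (f : RatFunc 𝕂) :
    barU 𝕂 (algebraMap (RatFunc 𝕂) (U 𝕂) f) = algebraMap (RatFunc 𝕂) (U 𝕂) (barQ 𝕂 f) :=
  congrArg (toTwisted 𝕂).symm ((barTwisted 𝕂).commutes f)

@[simp] lemma barU_ofGen (𝕂 : Type u) [Field 𝕂] (g : Gen) :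
    barU 𝕂 (ofGen 𝕂 g) = ofGen 𝕂 (barGen g) :=
  congrArg (toTwisted 𝕂).symm ((liftU_proj 𝕂 (barFree 𝕂) (barFree_rel 𝕂)
    (gen 𝕂 g)).trans (FreeAlgebra.lift_ι_apply _ _))

/-! ### The positive part and its completion -/

/-- The subalgebra `U⁺` generated by `E₁, E₂`. -/
def Upos (𝕂 : Type u) [Field 𝕂] : Subalgebra (RatFunc 𝕂) (U 𝕂) :=
  Algebra.adjoin (RatFunc 𝕂) (Set.range (E 𝕂))

/-- The weight space `U⁺_μ = {x ∈ U⁺ | Kᵢ x Kᵢ⁻¹ = q^{(αᵢ, μ)} x}`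
for `μ = μ₁ α₁ + μ₂ α₂ ∈ Q⁺`, where `(αᵢ, μ) = ∑ⱼ a_{ij} μⱼ`. -/
def UposWt (𝕂 : Type u) [Field 𝕂] (m : Fin 2 → ℕ) : Submodule (RatFunc 𝕂) (U 𝕂) where
  carrier := {x | x ∈ Upos 𝕂 ∧ ∀ i, (K 𝕂 i : U 𝕂) * x * ((K 𝕂 i)⁻¹ : (U 𝕂)ˣ) =
    q 𝕂 ^ (∑ j, cartan i j * m j) • x}
  zero_mem' := by simp [zero_mem]
  add_mem' := by
    rintro x y ⟨hx, hx'⟩ ⟨hy, hy'⟩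
    refine ⟨add_mem hx hy, fun i => ?_⟩
    rw [mul_add, add_mul, hx', hy', smul_add]
  smul_mem' := by
    rintro r x ⟨hx, hx'⟩
    refine ⟨Subalgebra.smul_mem _ hx r, fun i => ?_⟩
    rw [mul_smul_comm, smul_mul_assoc, hx', smul_comm]

/-- The completion `Û⁺ = ∏_{μ ∈ Q⁺} U⁺_μ`. -/
abbrev Uhat (𝕂 : Type u) [Field 𝕂] : Type u := ∀ m : Fin 2 → ℕ, UposWt 𝕂 m

/-- The weight space `M_n = {v | Kᵢ v = q^{nᵢ} v}` of a `U`-module, for the integral weight `λ`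
with `(λ, αᵢ) = nᵢ`. -/
def weightSpace (𝕂 : Type u) [Field 𝕂] (M : Type u) [AddCommGroup M] [Module (RatFunc 𝕂) M]
    [Module (U 𝕂) M] [IsScalarTower (RatFunc 𝕂) (U 𝕂) M] (n : Fin 2 → ℤ) :
    Submodule (RatFunc 𝕂) M where
  carrier := {v | ∀ i, (K 𝕂 i : U 𝕂) • v = q 𝕂 ^ n i • v}
  zero_mem' := by simp
  add_mem' := by
    intro v w hv hw i
    rw [smul_add, smul_add, hv, hw]
  smul_mem' := by
    intro r v hv i
    rw [← algebraMap_smul (U 𝕂) r v, smul_smul, ← Algebra.commutes, mul_smul, hv,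
      algebraMap_smul, algebraMap_smul, smul_comm]

/-- The objects of `𝒪_int`: finite-dimensional `U`-modules of type 1, that is, those spanned by
weight vectors for integral weights. -/
structure IntModule (𝕂 : Type u) [Field 𝕂] : Type (u + 1) where
  carrier : Type u
  [addCommGroup : AddCommGroup carrier]
  [module : Module (RatFunc 𝕂) carrier]
  [moduleU : Module (U 𝕂) carrier]
  [isScalarTower : IsScalarTower (RatFunc 𝕂) (U 𝕂) carrier]
  [finite : Module.Finite (RatFunc 𝕂) carrier]
  type_one : ⨆ n : Fin 2 → ℤ, weightSpace 𝕂 carrier n = ⊤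

attribute [instance] IntModule.addCommGroup IntModule.module IntModule.moduleU
  IntModule.isScalarTower IntModule.finite

/-- The algebra `𝒰` of natural endomorphisms of the forgetful functor from `𝒪_int` to vector
spaces: families of linear maps `a_M : M → M` commuting with all `U`-module homomorphisms. -/
def Ucompl (𝕂 : Type u) [Field 𝕂] :
    Subalgebra (RatFunc 𝕂) (∀ M : IntModule 𝕂, Module.End (RatFunc 𝕂) M.carrier) where
  carrier := {a | ∀ (M N : IntModule 𝕂) (f : M.carrier →ₗ[U 𝕂] N.carrier) (v : M.carrier),
    f (a M v) = a N (f v)}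
  mul_mem' := by
    intro a b ha hb M N f v
    simp only [Pi.mul_apply, Module.End.mul_apply]
    rw [ha, hb]
  add_mem' := by
    intro a b ha hb M N f v
    simp only [Pi.add_apply, LinearMap.add_apply, map_add]
    rw [ha, hb]
  algebraMap_mem' := by
    intro r M N f v
    simp only [Pi.algebraMap_apply, Module.algebraMap_end_apply]
    rw [← algebraMap_smul (U 𝕂) r v, map_smul, algebraMap_smul]

/-- The canonical algebra homomorphism `U → 𝒰`. -/
def ofU (𝕂 : Type u) [Field 𝕂] : U 𝕂 →ₐ[RatFunc 𝕂] Ucompl 𝕂 :=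
  AlgHom.codRestrict
    (AlgHom.pi (R := RatFunc 𝕂) (fun M : IntModule 𝕂 =>
      Algebra.lsmul (RatFunc 𝕂) (RatFunc 𝕂) M.carrier (A := U 𝕂)))
    (Ucompl 𝕂) (fun x M N f v => by simp)

/-- An element of `Û⁺` has only finitely many components that act non-trivially on a given
module in `𝒪_int`. -/
lemma finite_support_action (𝕂 : Type u) [Field 𝕂] (M : IntModule 𝕂) :
    {m : Fin 2 → ℕ | ∃ x ∈ UposWt 𝕂 m, ∃ v : M.carrier, x • v ≠ 0}.Finite := by
  set S : Set (Fin 2 → ℤ) := {n | weightSpace 𝕂 M.carrier n ≠ ⊥} with hS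
  have hSfin : S.Finite := by
    let e : Fin 2 → Module.End (RatFunc 𝕂) M.carrier := fun i =>
      Algebra.lsmul (RatFunc 𝕂) (RatFunc 𝕂) M.carrier (A := U 𝕂) (K 𝕂 i : U 𝕂)
    have hT : ∀ i, {z : ℤ | (e i).HasEigenvalue (q 𝕂 ^ z)}.Finite := fun i =>
      Set.Finite.preimage (q_zpow_injective 𝕂).injOn (e i).finite_hasEigenvalue
    refine (Set.Finite.pi' hT).subset ?_
    intro n hn i
    obtain ⟨v, hv, hv0⟩ := (Submodule.ne_bot_iff _).1 hn
    exact Module.End.hasEigenvalue_of_hasEigenvector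
      (Module.End.hasEigenvector_iff.2 ⟨Module.End.mem_eigenspace_iff.2 (hv i), hv0⟩)
  have hfin : ((fun p : (Fin 2 → ℤ) × (Fin 2 → ℤ) => p.1 - p.2) '' (S ×ˢ S)).Finite :=
    (hSfin.prod hSfin).image _
  have hinj : Function.Injective (fun (m : Fin 2 → ℕ) (i : Fin 2) => ∑ j, cartan i j * (m j : ℤ)) := by
    intro m m' h
    funext i
    have := congrFun h i
    fin_cases i <;> simpa [cartan] using this
  refine (hfin.preimage hinj.injOn).subset ?_
  rintro m ⟨x, hx, v, hv⟩
  have : ∃ n, ∃ w ∈ weightSpace 𝕂 M.carrier n, x • w ≠ 0 := by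
    by_contra! hcon
    apply hv
    have hle : (⨆ n, weightSpace 𝕂 M.carrier n) ≤
        LinearMap.ker (Algebra.lsmul (RatFunc 𝕂) (RatFunc 𝕂) M.carrier (A := U 𝕂) x) :=
      iSup_le fun n w hw => by
        rw [LinearMap.mem_ker]
        exact hcon n w hw
    rw [M.type_one] at hle
    exact LinearMap.mem_ker.1 (hle (Submodule.mem_top (x := v)))
  obtain ⟨n, w, hw, hxw⟩ := this
  have hxw' : x • w ∈ weightSpace 𝕂 M.carrier (fun i => (∑ j, cartan i j * (m j : ℤ)) + n i) := by
    intro i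
    have h1 : (K 𝕂 i : U 𝕂) * x = (q 𝕂 ^ (∑ j, cartan i j * (m j : ℤ)) • x) * (K 𝕂 i : U 𝕂) := by
      rw [← hx.2 i]
      simp [mul_assoc]
    rw [smul_smul, h1, mul_smul, hw i, smul_assoc, zpow_add₀ (q_ne_zero 𝕂), mul_smul,
      ← algebraMap_smul (U 𝕂) (q 𝕂 ^ n i) w, smul_smul x, ← Algebra.commutes, mul_smul,
      algebraMap_smul]
  refine ⟨(fun i => (∑ j, cartan i j * (m j : ℤ)) + n i, n), ⟨?_, ?_⟩, ?_⟩
  · exact (Submodule.ne_bot_iff _).2 ⟨_, hxw', hxw⟩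
  · exact (Submodule.ne_bot_iff _).2 ⟨w, hw, fun h => hxw (by rw [h, smul_zero])⟩
  · funext i
    simp

lemma finite_support_smul (𝕂 : Type u) [Field 𝕂] (M : IntModule 𝕂) (a : Uhat 𝕂)
    (v : M.carrier) : (Function.support fun m => (a m : U 𝕂) • v).Finite :=
  (finite_support_action 𝕂 M).subset fun m hm => ⟨a m, (a m).2, v, hm⟩

/-- The canonical map `Û⁺ → 𝒰`: the element `∑_μ a_μ` acts on a module in `𝒪_int` by
`v ↦ ∑_μ a_μ v`, a finite sum. -/
def ofUhat (𝕂 : Type u) [Field 𝕂] (a : Uhat 𝕂) : Ucompl 𝕂 where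
  val M :=
    { toFun := fun v => ∑ᶠ m, (a m : U 𝕂) • v
      map_add' := fun v w => by
        simp only [smul_add]
        exact finsum_add_distrib (finite_support_smul 𝕂 M a v) (finite_support_smul 𝕂 M a w)
      map_smul' := fun r v => by
        have h : ∀ x : U 𝕂, x • r • v = r • x • v := fun x => by
          rw [← algebraMap_smul (U 𝕂) r v, smul_smul, ← Algebra.commutes, mul_smul,
            algebraMap_smul]
        simp only [h, RingHom.id_apply]
        exact (smul_finsum' r (finite_support_smul 𝕂 M a v)).symm }
  property := by
    intro M N f v
    have := AddMonoidHom.map_finsum f.toAddMonoidHom (finite_support_smul 𝕂 M a v)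
    simpa using this

/-! ### The quantum symmetric pair coideal subalgebra and the quasi K-matrix -/

/-- The diagram automorphism `τ`, which swaps the two nodes. -/
def tau : Equiv.Perm (Fin 2) := Equiv.swap 0 1

/-- The involution `Θ = -w_X τ = -τ` of the root lattice. -/
def Theta (l : Fin 2 → ℤ) : Fin 2 → ℤ := fun i => -l (tau i)

/-- The parameters `𝐜 = (c₁, c₂)` allowed for the bar involution: both are non-zero,
`cᵢ = c_{τ(i)}` because `(αᵢ, Θ(αᵢ)) = 0`, and `c_{τ(i)} = q^{(αᵢ, Θ(αᵢ))} \bar{cᵢ}`. -/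
structure IsParameter (𝕂 : Type u) [Field 𝕂] (c : Fin 2 → RatFunc 𝕂) : Prop where
  ne_zero : ∀ i, c i ≠ 0
  tau_eq : ∀ i, c i = c (tau i)
  bar_eq : ∀ i, c (tau i) = barQ 𝕂 (c i)

/-- The subalgebra `U⁰_Θ` generated by the `K_λ` with `Θ(λ) = λ`. -/
def UzeroTheta (𝕂 : Type u) [Field 𝕂] : Subalgebra (RatFunc 𝕂) (U 𝕂) :=
  Algebra.adjoin (RatFunc 𝕂) {x | ∃ l : Fin 2 → ℤ, Theta l = l ∧ x = (Kroot 𝕂 l : U 𝕂)}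

/-- The generator `Bᵢ = Fᵢ - cᵢ s(τ(i)) T_{w_X}(E_{τ(i)}) Kᵢ⁻¹ + sᵢ Kᵢ⁻¹`, where `X = ∅`,
`s(1) = s(2) = 1` and `𝐬 = (0, 0)`. -/
def B (𝕂 : Type u) [Field 𝕂] (c : Fin 2 → RatFunc 𝕂) (i : Fin 2) : U 𝕂 :=
  F 𝕂 i - c i • (E 𝕂 (tau i) * ((K 𝕂 i)⁻¹ : (U 𝕂)ˣ))

/-- The quantum symmetric pair coideal subalgebra `B_𝐜`, generated by `U⁰_Θ` and `B₁, B₂`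
(the generators coming from `X` are absent, as `X = ∅`). -/
def Bc (𝕂 : Type u) [Field 𝕂] (c : Fin 2 → RatFunc 𝕂) : Subalgebra (RatFunc 𝕂) (U 𝕂) :=
  Algebra.adjoin (RatFunc 𝕂) ((UzeroTheta 𝕂 : Set (U 𝕂)) ∪ Set.range (B 𝕂 c))

/-- `φ` is the bar involution of `B_𝐜`: it agrees with the bar involution of `U` on `U⁰_Θ`
and fixes `B₁, B₂`. -/
def IsBarInvolution (𝕂 : Type u) [Field 𝕂] (c : Fin 2 → RatFunc 𝕂)
    (φ : Bc 𝕂 c ≃ₐ[𝕂] Bc 𝕂 c) : Prop :=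
  (∀ b : Bc 𝕂 c, (b : U 𝕂) ∈ UzeroTheta 𝕂 → (φ b : U 𝕂) = barU 𝕂 b) ∧
  ∀ (i : Fin 2) (b : Bc 𝕂 c), (b : U 𝕂) = B 𝕂 c i → φ b = b

/-- `𝔛 = ∑_μ 𝔛_μ ∈ Û⁺` is a quasi K-matrix for `B_𝐜` with bar involution `φ`: `𝔛₀ = 1` and
`φ(b) 𝔛 = 𝔛 \bar{b}` holds in `𝒰` for all `b ∈ B_𝐜`. -/
def IsQuasiKMatrix (𝕂 : Type u) [Field 𝕂] (c : Fin 2 → RatFunc 𝕂)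
    (φ : Bc 𝕂 c ≃ₐ[𝕂] Bc 𝕂 c) (𝔛 : Uhat 𝕂) : Prop :=
  (𝔛 0 : U 𝕂) = 1 ∧
  ∀ b : Bc 𝕂 c, ofU 𝕂 (φ b : U 𝕂) * ofUhat 𝕂 𝔛 = ofUhat 𝕂 𝔛 * ofU 𝕂 (barU 𝕂 b)

/-! ### The explicit formula -/

/-- `{n} = 1 + q² + ⋯ + q^{2(n-1)}` -/
def qbrace (𝕂 : Type u) [Field 𝕂] (n : ℕ) : RatFunc 𝕂 := ∑ k ∈ Finset.range n, q 𝕂 ^ (2 * k)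

/-- `{n}! = {1}{2}⋯{n}` -/
def qbraceFactorial (𝕂 : Type u) [Field 𝕂] (n : ℕ) : RatFunc 𝕂 :=
  ∏ k ∈ Finset.range n, qbrace 𝕂 (k + 1)

end AIII11

end

noncomputable section

namespace AIII11

open Polynomial

variable {𝕂 : Type u} [Field 𝕂] {N : ℤ}

/-! ### Relations in `U` -/

/-! Bar involution of `Bc`. The elements `B 0`, `B 1` and `L` = K₁K₂⁻¹ satisfy the relations of one
copy of U_q(sl₂): both `B i` are homogeneous for `L`, and since c₁ = c₂ their commutator is a
multiple of L - L⁻¹ (`B_commutator`). Hence there is an algebra map `retraction` from `U` to itself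
that sends the first sl₂ to this copy, kills E₂ and F₂, and sends K₂ to 1. It sends each `barU (B
i)` back to `B i`, so `retraction ∘ barU` restricts to the required involution, and no presentation
of `Bc` is needed. Uniqueness is a check on generators.

Existence of 𝔛. Write e = E₁E₂ and a_n for the proposed coefficients. The commutator of Fᵢ with
e^(n+1) is a multiple of E_τ(i)Kᵢ⁻¹eⁿ - eⁿE_τ(i)Kᵢ (`F_commutator_E_mul_E_pow_succ`), and the
recursion for a_n turns that multiple into cᵢa_n (`quasiKCoeff_succ`). Summing over n gives Bᵢ𝔛 =
𝔛·bar(Bᵢ); on each finite-dimensional module the sum may be truncated. Also L commutes with e, and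
the intertwining property passes to sums and products.

Uniqueness of 𝔛. Apply the relation for `B i` to the lowest weight vector of the tensor product of
two simple modules of highest weight N, realised as functions on the box [0, N]². There Fᵢ acts by
zero, Kᵢ by a scalar, and Eᵢ commutes with 𝔛, so the image of the vector under 𝔛 obeys a recursion
on height (`lowestImage_recurrence`) started by 𝔛₀ = 1. Each weight space of U⁺ is spanned by one
monomial (`exists_eq_smul_monomial`), which does not kill the vector once N is large, so every 𝔛_μ
can be read off. -/

lemma barQ_barQ (r : RatFunc 𝕂) : barQ 𝕂 (barQ 𝕂 r) = r := by
  have h : ∀ p : 𝕂[X], barQ 𝕂 (barQ 𝕂 (algebraMap 𝕂[X] (RatFunc 𝕂) p)) =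
      algebraMap 𝕂[X] (RatFunc 𝕂) p := by
    intro p
    have : ((barQ 𝕂).comp (barQ 𝕂)).comp (IsScalarTower.toAlgHom 𝕂 𝕂[X] (RatFunc 𝕂)) =
        IsScalarTower.toAlgHom 𝕂 𝕂[X] (RatFunc 𝕂) := by
      apply Polynomial.algHom_ext
      simp
    exact DFunLike.congr_fun this p
  obtain ⟨a, b, -, rfl⟩ := IsFractionRing.div_surjective (A := 𝕂[X]) r
  rw [map_div₀, map_div₀, h, h]

lemma q_sub_q_inv_ne_zero : q 𝕂 - (q 𝕂)⁻¹ ≠ 0 := by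
  intro h
  apply q_pow_ne_one 𝕂 (n := 2) two_ne_zero
  rw [sub_eq_zero] at h
  rw [pow_two]
  nth_rw 1 [h]
  exact inv_mul_cancel₀ (q_ne_zero 𝕂)

lemma tau_ne (i : Fin 2) : tau i ≠ i := by
  fin_cases i <;> simp [tau]

lemma K_val (i : Fin 2) : (K 𝕂 i : U 𝕂) = ofGen 𝕂 (.K i) := rfl

lemma K_inv_val (i : Fin 2) : (((K 𝕂 i)⁻¹ : (U 𝕂)ˣ) : U 𝕂) = ofGen 𝕂 (.Kinv i) := rfl

lemma K_commute (i j : Fin 2) : Commute (K 𝕂 i) (K 𝕂 j) := by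
  ext
  have := proj_rel 𝕂 (Rel.K_comm i j)
  rw [map_mul, map_mul] at this
  exact this

lemma K_mul_E (i j : Fin 2) :
    (K 𝕂 i : U 𝕂) * E 𝕂 j = q 𝕂 ^ cartan i j • (E 𝕂 j * (K 𝕂 i : U 𝕂)) := by
  have := proj_rel 𝕂 (Rel.K_E i j)
  simp only [map_mul, map_smul] at this
  rw [← smul_mul_assoc]
  exact (Units.mul_inv_eq_iff_eq_mul (K 𝕂 i)).1 this

lemma K_mul_F (i j : Fin 2) :
    (K 𝕂 i : U 𝕂) * F 𝕂 j = q 𝕂 ^ (-cartan i j) • (F 𝕂 j * (K 𝕂 i : U 𝕂)) := by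
  have := proj_rel 𝕂 (Rel.K_F i j)
  simp only [map_mul, map_smul] at this
  rw [← smul_mul_assoc]
  exact (Units.mul_inv_eq_iff_eq_mul (K 𝕂 i)).1 this

lemma inv_mul_of_mul_eq {x : U 𝕂} {k : (U 𝕂)ˣ} {n : ℤ}
    (h : (k : U 𝕂) * x = q 𝕂 ^ n • (x * (k : U 𝕂))) :
    ((k⁻¹ : (U 𝕂)ˣ) : U 𝕂) * x = q 𝕂 ^ (-n) • (x * ((k⁻¹ : (U 𝕂)ˣ) : U 𝕂)) := by
  have h2 : x * ((k⁻¹ : (U 𝕂)ˣ) : U 𝕂) = q 𝕂 ^ n • (((k⁻¹ : (U 𝕂)ˣ) : U 𝕂) * x) := by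
    rw [Units.mul_inv_eq_iff_eq_mul, smul_mul_assoc, mul_assoc, ← mul_smul_comm,
      Units.eq_inv_mul_iff_mul_eq, h]
  rw [h2, smul_smul, ← zpow_add₀ (q_ne_zero 𝕂)]
  simp

lemma Kinv_mul_E (i j : Fin 2) :
    (((K 𝕂 i)⁻¹ : (U 𝕂)ˣ) : U 𝕂) * E 𝕂 j =
      q 𝕂 ^ (-cartan i j) • (E 𝕂 j * (((K 𝕂 i)⁻¹ : (U 𝕂)ˣ) : U 𝕂)) :=
  inv_mul_of_mul_eq (K_mul_E i j)

lemma Kinv_mul_F (i j : Fin 2) :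
    (((K 𝕂 i)⁻¹ : (U 𝕂)ˣ) : U 𝕂) * F 𝕂 j =
      q 𝕂 ^ (cartan i j) • (F 𝕂 j * (((K 𝕂 i)⁻¹ : (U 𝕂)ˣ) : U 𝕂)) := by
  simpa using inv_mul_of_mul_eq (K_mul_F (𝕂 := 𝕂) i j)

lemma E_F_same (i : Fin 2) : E 𝕂 i * F 𝕂 i - F 𝕂 i * E 𝕂 i =
    (q 𝕂 - (q 𝕂)⁻¹)⁻¹ • ((K 𝕂 i : U 𝕂) - ((K 𝕂 i)⁻¹ : (U 𝕂)ˣ)) := by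
  have := proj_rel 𝕂 (Rel.E_F_same i)
  simp only [map_mul, map_sub, map_smul] at this
  exact this

lemma E_F_ne {i j : Fin 2} (h : i ≠ j) : E 𝕂 i * F 𝕂 j = F 𝕂 j * E 𝕂 i := by
  have := proj_rel 𝕂 (Rel.E_F_ne i j h)
  simp only [map_mul, map_sub, map_zero] at this
  exact sub_eq_zero.1 this

lemma E_commute (i j : Fin 2) : Commute (E 𝕂 i) (E 𝕂 j) := by
  by_cases h : i = j
  · rw [h]
  · have := proj_rel 𝕂 (Rel.serre_E i j h)
    simp only [map_mul, map_sub, map_zero] at this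
    exact sub_eq_zero.1 this

lemma F_commute (i j : Fin 2) : Commute (F 𝕂 i) (F 𝕂 j) := by
  by_cases h : i = j
  · rw [h]
  · have := proj_rel 𝕂 (Rel.serre_F i j h)
    simp only [map_mul, map_sub, map_zero] at this
    exact sub_eq_zero.1 this

/-! ### The subalgebra `U⁰_Θ` -/

/-- `K₁ K₂⁻¹` -/
def L (𝕂 : Type u) [Field 𝕂] : (U 𝕂)ˣ := K 𝕂 0 * (K 𝕂 1)⁻¹

/-- The Θ-fixed lattice has rank one, so U⁰_Θ is generated by the powers of `L`. -/
lemma Theta_eq_iff (l : Fin 2 → ℤ) : Theta l = l ↔ l 1 = -l 0 := by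
  constructor
  · intro h
    have := congrFun h 1
    simp [Theta, tau] at this
    omega
  · intro h
    funext i
    fin_cases i <;> simp [Theta, tau, h]

lemma Kroot_eq_L_zpow {l : Fin 2 → ℤ} (h : Theta l = l) : Kroot 𝕂 l = L 𝕂 ^ l 0 := by
  rw [Theta_eq_iff] at h
  rw [Kroot, L, h, (K_commute 0 1).inv_right.mul_zpow, inv_zpow, zpow_neg]

lemma Theta_neg {l : Fin 2 → ℤ} (h : Theta l = l) : Theta (-l) = -l := by
  rw [Theta_eq_iff] at *
  simp [h]

lemma map_barU_K (i : Fin 2) : Units.map (barU 𝕂 : U 𝕂 →* U 𝕂) (K 𝕂 i) = (K 𝕂 i)⁻¹ := by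
  ext
  exact barU_ofGen 𝕂 (.K i)

lemma map_barU_L : Units.map (barU 𝕂 : U 𝕂 →* U 𝕂) (L 𝕂) = (L 𝕂)⁻¹ := by
  rw [L, map_mul, map_inv, map_barU_K, map_barU_K, mul_inv_rev, inv_inv]
  exact ((K_commute 0 1).inv_left).eq

lemma barU_Kroot {l : Fin 2 → ℤ} (h : Theta l = l) :
    barU 𝕂 (Kroot 𝕂 l : U 𝕂) = (Kroot 𝕂 (-l) : U 𝕂) := by
  rw [Kroot_eq_L_zpow h, Kroot_eq_L_zpow (Theta_neg h)]
  have := map_zpow (Units.map (barU 𝕂 : U 𝕂 →* U 𝕂)) (L 𝕂) (l 0)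
  rw [map_barU_L, inv_zpow'] at this
  exact congrArg Units.val this

lemma L_mul_E (j : Fin 2) : (L 𝕂 : U 𝕂) * E 𝕂 j =
    q 𝕂 ^ (cartan 0 j - cartan 1 j) • (E 𝕂 j * (L 𝕂 : U 𝕂)) := by
  rw [L, Units.val_mul, mul_assoc, Kinv_mul_E, mul_smul_comm, ← mul_assoc, K_mul_E,
    smul_mul_assoc, smul_smul, ← zpow_add₀ (q_ne_zero 𝕂), mul_assoc]
  congr 2
  ring

lemma L_mul_F (j : Fin 2) : (L 𝕂 : U 𝕂) * F 𝕂 j =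
    q 𝕂 ^ (cartan 1 j - cartan 0 j) • (F 𝕂 j * (L 𝕂 : U 𝕂)) := by
  rw [L, Units.val_mul, mul_assoc, Kinv_mul_F, mul_smul_comm, ← mul_assoc, K_mul_F,
    smul_mul_assoc, smul_smul, ← zpow_add₀ (q_ne_zero 𝕂), mul_assoc]
  congr 2

lemma L_commute_K (i : Fin 2) : Commute (L 𝕂) (K 𝕂 i) :=
  (K_commute 0 i).mul_left (K_commute 1 i).inv_left

/-- The two summands Fᵢ and E_τ(i)Kᵢ⁻¹ of `B i` have the same weight under conjugation by `L`,
because τ and the sign change in passing from F to E cancel. -/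
lemma L_mul_B (c : Fin 2 → RatFunc 𝕂) (i : Fin 2) : (L 𝕂 : U 𝕂) * B 𝕂 c i =
    q 𝕂 ^ (cartan 1 i - cartan 0 i) • (B 𝕂 c i * (L 𝕂 : U 𝕂)) := by
  have hK : (L 𝕂 : U 𝕂) * ((K 𝕂 i)⁻¹ : (U 𝕂)ˣ) = ((K 𝕂 i)⁻¹ : (U 𝕂)ˣ) * (L 𝕂 : U 𝕂) := by
    exact_mod_cast congrArg Units.val (L_commute_K (𝕂 := 𝕂) i).inv_right.eq
  have hc : cartan 0 (tau i) - cartan 1 (tau i) = cartan 1 i - cartan 0 i := by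
    fin_cases i <;> simp [cartan, tau]
  rw [B, mul_sub, L_mul_F, mul_smul_comm, ← mul_assoc, L_mul_E, hc, sub_mul, smul_sub,
    smul_mul_assoc, smul_mul_assoc, mul_assoc, mul_assoc, hK, smul_comm]

lemma E_mul_Kinv_commute (i : Fin 2) :
    Commute (E 𝕂 (tau i) * ((K 𝕂 i)⁻¹ : (U 𝕂)ˣ))
      (E 𝕂 i * ((K 𝕂 (tau i))⁻¹ : (U 𝕂)ˣ)) := by
  have key : ∀ i j : Fin 2, (E 𝕂 j * ((K 𝕂 i)⁻¹ : (U 𝕂)ˣ)) *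
      (E 𝕂 i * ((K 𝕂 j)⁻¹ : (U 𝕂)ˣ)) = q 𝕂 ^ (-2 : ℤ) •
        (E 𝕂 j * E 𝕂 i * (((K 𝕂 i)⁻¹ * (K 𝕂 j)⁻¹ : (U 𝕂)ˣ) : U 𝕂)) := by
    intro i j
    rw [mul_assoc, ← mul_assoc _ (E 𝕂 i), Kinv_mul_E]
    simp [cartan, mul_assoc]
  rw [commute_iff_eq, key, key, (E_commute (tau i) i).eq,
    ((K_commute i (tau i)).inv_inv).eq]

/-- The terms F₁F₂ cancel, and so do the terms quadratic in c by `E_mul_Kinv_commute`. What remains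
is c([E₁,F₁]K₂⁻¹ - [E₂,F₂]K₁⁻¹), in which the two copies of K₁⁻¹K₂⁻¹ cancel because c₁ = c₂. -/
lemma B_commutator {c : Fin 2 → RatFunc 𝕂} (hc : c 0 = c 1) :
    B 𝕂 c 0 * B 𝕂 c 1 - B 𝕂 c 1 * B 𝕂 c 0 =
      (c 0 * (q 𝕂 - (q 𝕂)⁻¹)⁻¹) • ((L 𝕂 : U 𝕂) - ((L 𝕂)⁻¹ : (U 𝕂)ˣ)) := by
  have t0 : tau 0 = 1 := by simp [tau]
  have t1 : tau 1 = 0 := by simp [tau]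
  have hEK := (E_mul_Kinv_commute (𝕂 := 𝕂) 0).eq
  rw [t0] at hEK
  have hL : ((L 𝕂)⁻¹ : (U 𝕂)ˣ) = K 𝕂 1 * (K 𝕂 0)⁻¹ := by rw [L, mul_inv_rev, inv_inv]
  have h1 := Kinv_mul_F (𝕂 := 𝕂) 1 0
  have h0 := Kinv_mul_F (𝕂 := 𝕂) 0 1
  simp only [cartan, one_ne_zero, zero_ne_one, if_false, zpow_zero, one_smul] at h0 h1
  have e0 := E_F_same (𝕂 := 𝕂) 0
  have e1 := E_F_same (𝕂 := 𝕂) 1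
  have hF := (F_commute (𝕂 := 𝕂) 0 1).eq
  have hKK := congrArg Units.val ((K_commute (𝕂 := 𝕂) 1 0).inv_inv).eq
  rw [hL, L]
  simp only [Units.val_mul] at *
  simp only [B, t0, t1, ← hc]
  -- Only the commutation rules collected above matter from here on, so the Kᵢ and their inverses
  -- become independent symbols.
  generalize (((K 𝕂 0)⁻¹ : (U 𝕂)ˣ) : U 𝕂) = k0 at *
  generalize (((K 𝕂 1)⁻¹ : (U 𝕂)ˣ) : U 𝕂) = k1 at *
  generalize ((K 𝕂 0 : (U 𝕂)ˣ) : U 𝕂) = K0 at *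
  generalize ((K 𝕂 1 : (U 𝕂)ˣ) : U 𝕂) = K1 at *
  generalize (q 𝕂 - (q 𝕂)⁻¹)⁻¹ = d at *
  simp only [mul_sub, sub_mul, mul_smul_comm, smul_mul_assoc, hEK]
  have a1 : E 𝕂 0 * k1 * F 𝕂 0 = E 𝕂 0 * F 𝕂 0 * k1 := by rw [mul_assoc, h1, mul_assoc]
  have a2 : E 𝕂 1 * k0 * F 𝕂 1 = E 𝕂 1 * F 𝕂 1 * k0 := by rw [mul_assoc, h0, mul_assoc]
  rw [hF, a1, a2, eq_add_of_sub_eq e0, eq_add_of_sub_eq e1, mul_smul]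
  simp only [add_mul, smul_mul_assoc, sub_mul, ← mul_assoc, hKK, smul_sub, smul_add]
  abel

/-! ### The retraction `U → B_𝐜` -/

/-- The images of the generators under the retraction `U → B_𝐜`. -/
def retractionGen (c : Fin 2 → RatFunc 𝕂) : Gen → U 𝕂
  | .E i => if i = 0 then -(c 0)⁻¹ • B 𝕂 c 1 else 0
  | .F i => if i = 0 then B 𝕂 c 0 else 0
  | .K i => if i = 0 then (L 𝕂 : U 𝕂) else 1
  | .Kinv i => if i = 0 then ((L 𝕂)⁻¹ : (U 𝕂)ˣ) else 1

/-- Relations within the second sl₂, or mixing the two, hold trivially because that factor goes to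
the trivial representation. Those of the first sl₂ are `L_mul_B` and `B_commutator`, the factor
-c₁⁻¹ normalising the latter. -/
lemma retraction_rel {c : Fin 2 → RatFunc 𝕂} (hc : IsParameter 𝕂 c) ⦃x y : Free 𝕂⦄
    (h : Rel 𝕂 x y) : FreeAlgebra.lift (RatFunc 𝕂) (retractionGen c) x =
      FreeAlgebra.lift (RatFunc 𝕂) (retractionGen c) y := by
  have hc0 : c 0 ≠ 0 := hc.ne_zero 0
  have hc1 : c 0 = c 1 := by simpa [tau] using hc.tau_eq 0
  have hB0 := L_mul_B c 0
  have hB1 := L_mul_B c 1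
  have hB := B_commutator hc1
  simp only [cartan, if_true, one_ne_zero, zero_ne_one, if_false, zero_sub, sub_zero] at hB0 hB1
  cases h with
  | K_mul_Kinv i => fin_cases i <;> simp [retractionGen]
  | Kinv_mul_K i => fin_cases i <;> simp [retractionGen]
  | K_comm i j => fin_cases i <;> fin_cases j <;> simp [retractionGen]
  | K_E i j => fin_cases i <;> fin_cases j <;> simp [retractionGen, cartan, hB1]; rw [smul_comm]
  | K_F i j => fin_cases i <;> fin_cases j <;> simp [retractionGen, cartan, hB0]
  | E_F_same i =>
    fin_cases i
    · simp only [map_sub, map_mul, map_smul, FreeAlgebra.lift_ι_apply, retractionGen]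
      simp only [Fin.zero_eta, if_true, smul_mul_assoc, mul_smul_comm]
      have := congrArg (fun z => (c 0)⁻¹ • z) hB
      simp only [smul_smul, inv_mul_cancel_left₀ hc0] at this
      rw [← this, smul_sub, neg_smul, neg_smul, neg_sub_neg]
    · simp [retractionGen]
  | E_F_ne i j hij => fin_cases i <;> fin_cases j <;> simp_all [retractionGen]
  | serre_E i j hij => fin_cases i <;> fin_cases j <;> simp_all [retractionGen]
  | serre_F i j hij => fin_cases i <;> fin_cases j <;> simp_all [retractionGen]

/-- The algebra endomorphism of `U` which is a retraction onto `B_𝐜`. -/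
def retraction {c : Fin 2 → RatFunc 𝕂} (hc : IsParameter 𝕂 c) : U 𝕂 →ₐ[RatFunc 𝕂] U 𝕂 :=
  liftU 𝕂 (FreeAlgebra.lift (RatFunc 𝕂) (retractionGen c)) (retraction_rel hc)

lemma retraction_ofGen {c : Fin 2 → RatFunc 𝕂} (hc : IsParameter 𝕂 c) (g : Gen) :
    retraction hc (ofGen 𝕂 g) = retractionGen c g :=
  (liftU_proj 𝕂 _ (retraction_rel hc) (gen 𝕂 g)).trans (FreeAlgebra.lift_ι_apply _ _)

lemma retraction_Kroot {c : Fin 2 → RatFunc 𝕂} (hc : IsParameter 𝕂 c) {l : Fin 2 → ℤ}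
    (h : Theta l = l) : retraction hc (Kroot 𝕂 l : U 𝕂) = (Kroot 𝕂 l : U 𝕂) := by
  have h0 : Units.map (retraction hc : U 𝕂 →* U 𝕂) (K 𝕂 0) = L 𝕂 := by
    ext
    exact retraction_ofGen hc (.K 0)
  have h1 : Units.map (retraction hc : U 𝕂 →* U 𝕂) (K 𝕂 1) = 1 := by
    ext
    exact retraction_ofGen hc (.K 1)
  have hL : Units.map (retraction hc : U 𝕂 →* U 𝕂) (L 𝕂) = L 𝕂 := by
    conv_lhs => rw [L, map_mul, map_inv, h0, h1, inv_one, mul_one]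
  rw [Kroot_eq_L_zpow h]
  have := map_zpow (Units.map (retraction hc : U 𝕂 →* U 𝕂)) (L 𝕂) (l 0)
  rw [hL] at this
  exact congrArg Units.val this

/-- The bar conjugate of `Bᵢ` in `U`. -/
lemma barU_B {c : Fin 2 → RatFunc 𝕂} (hc : IsParameter 𝕂 c) (i : Fin 2) :
    barU 𝕂 (B 𝕂 c i) = F 𝕂 i - c i • (E 𝕂 (tau i) * (K 𝕂 i : U 𝕂)) := by
  have h : barQ 𝕂 (c i) = c i := by rw [← hc.bar_eq, ← hc.tau_eq]
  rw [B, map_sub, Algebra.smul_def, map_mul, map_mul, barU_algebraMap, h, ← Algebra.smul_def,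
    K_inv_val, barU_ofGen, barU_ofGen, barU_ofGen]
  rfl

/-- In bar(B₁) = F₁ - c₁E₂K₁ the second term dies. In bar(B₂) = F₂ - c₂E₁K₂ the first dies and the
second becomes c₂c₁⁻¹B₂ = B₂. -/
lemma retraction_barU_B {c : Fin 2 → RatFunc 𝕂} (hc : IsParameter 𝕂 c) (i : Fin 2) :
    retraction hc (barU 𝕂 (B 𝕂 c i)) = B 𝕂 c i := by
  have hc0 : c 0 ≠ 0 := hc.ne_zero 0
  have hc1 : c 0 = c 1 := by simpa [tau] using hc.tau_eq 0
  rw [barU_B hc, map_sub, map_smul, map_mul, K_val, retraction_ofGen, retraction_ofGen,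
    retraction_ofGen]
  fin_cases i
  · simp [retractionGen, tau]
  · simp [retractionGen, tau, ← hc1, smul_smul, hc0]

/-! ### The bar involution of `B_𝐜` -/

lemma Kroot_mem_UzeroTheta {l : Fin 2 → ℤ} (h : Theta l = l) :
    (Kroot 𝕂 l : U 𝕂) ∈ UzeroTheta 𝕂 :=
  Algebra.subset_adjoin ⟨l, h, rfl⟩

lemma UzeroTheta_le_Bc (c : Fin 2 → RatFunc 𝕂) : UzeroTheta 𝕂 ≤ Bc 𝕂 c :=
  fun _ hx => Algebra.subset_adjoin (Or.inl hx)

lemma B_mem_Bc (c : Fin 2 → RatFunc 𝕂) (i : Fin 2) : B 𝕂 c i ∈ Bc 𝕂 c :=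
  Algebra.subset_adjoin (Or.inr ⟨i, rfl⟩)

lemma retraction_barU_eq {c : Fin 2 → RatFunc 𝕂} (hc : IsParameter 𝕂 c) {x : U 𝕂}
    (hx : x ∈ UzeroTheta 𝕂) : retraction hc (barU 𝕂 x) = barU 𝕂 x ∧ barU 𝕂 x ∈ UzeroTheta 𝕂 ∧
      barU 𝕂 (barU 𝕂 x) = x := by
  induction hx using Algebra.adjoin_induction with
  | mem x hx =>
    obtain ⟨l, hl, rfl⟩ := hx
    rw [barU_Kroot hl, barU_Kroot (Theta_neg hl), neg_neg]
    exact ⟨retraction_Kroot hc (Theta_neg hl), Kroot_mem_UzeroTheta (Theta_neg hl), rfl⟩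
  | algebraMap r =>
    simp only [barU_algebraMap, barQ_barQ, AlgHom.commutes, and_true, true_and]
    exact Subalgebra.algebraMap_mem _ _
  | add x y _ _ hx hy =>
    simp only [map_add, hx.1, hy.1, hx.2.2, hy.2.2, and_true, true_and]
    exact add_mem hx.2.1 hy.2.1
  | mul x y _ _ hx hy =>
    simp only [map_mul, hx.1, hy.1, hx.2.2, hy.2.2, and_true, true_and]
    exact mul_mem hx.2.1 hy.2.1

/-- The ring endomorphism of `U` which restricts to the bar involution of `B_𝐜`. -/
def barRetraction {c : Fin 2 → RatFunc 𝕂} (hc : IsParameter 𝕂 c) : U 𝕂 →+* U 𝕂 :=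
  (retraction hc : U 𝕂 →+* U 𝕂).comp (barU 𝕂)

lemma barRetraction_apply {c : Fin 2 → RatFunc 𝕂} (hc : IsParameter 𝕂 c) (x : U 𝕂) :
    barRetraction hc x = retraction hc (barU 𝕂 x) := rfl

lemma barRetraction_algebraMap {c : Fin 2 → RatFunc 𝕂} (hc : IsParameter 𝕂 c) (r : RatFunc 𝕂) :
    barRetraction hc (algebraMap (RatFunc 𝕂) (U 𝕂) r) =
      algebraMap (RatFunc 𝕂) (U 𝕂) (barQ 𝕂 r) := by
  simp [barRetraction_apply]

/-- Stability of `Bc` and involutivity on it are both checked on generators; on all of `U` the map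
is not an involution. -/
lemma barRetraction_mem {c : Fin 2 → RatFunc 𝕂} (hc : IsParameter 𝕂 c) {x : U 𝕂}
    (hx : x ∈ Bc 𝕂 c) :
    barRetraction hc x ∈ Bc 𝕂 c ∧ barRetraction hc (barRetraction hc x) = x := by
  induction hx using Algebra.adjoin_induction with
  | mem x hx =>
    rcases hx with hx | ⟨i, rfl⟩
    · obtain ⟨h1, h2, h3⟩ := retraction_barU_eq hc hx
      rw [barRetraction_apply, h1, barRetraction_apply, (retraction_barU_eq hc h2).1, h3]
      exact ⟨UzeroTheta_le_Bc c h2, rfl⟩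
    · rw [barRetraction_apply, retraction_barU_B, barRetraction_apply, retraction_barU_B]
      exact ⟨B_mem_Bc c i, rfl⟩
  | algebraMap r =>
    simp only [barRetraction_algebraMap, barQ_barQ, and_true]
    exact Subalgebra.algebraMap_mem _ _
  | add x y _ _ hx hy =>
    simp only [map_add, hx.2, hy.2, and_true]
    exact add_mem hx.1 hy.1
  | mul x y _ _ hx hy =>
    simp only [map_mul, hx.2, hy.2, and_true]
    exact mul_mem hx.1 hy.1

/-- The bar involution of `B_𝐜`. -/
def barB {c : Fin 2 → RatFunc 𝕂} (hc : IsParameter 𝕂 c) : Bc 𝕂 c ≃ₐ[𝕂] Bc 𝕂 c where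
  toFun b := ⟨barRetraction hc b, (barRetraction_mem hc b.2).1⟩
  invFun b := ⟨barRetraction hc b, (barRetraction_mem hc b.2).1⟩
  left_inv b := Subtype.ext (barRetraction_mem hc b.2).2
  right_inv b := Subtype.ext (barRetraction_mem hc b.2).2
  map_mul' _ _ := Subtype.ext (map_mul _ _ _)
  map_add' _ _ := Subtype.ext (map_add _ _ _)
  commutes' r := by
    refine Subtype.ext ((barRetraction_algebraMap hc (algebraMap 𝕂 (RatFunc 𝕂) r)).trans ?_)
    rw [AlgHom.commutes]
    rfl

lemma coe_barB {c : Fin 2 → RatFunc 𝕂} (hc : IsParameter 𝕂 c) (b : Bc 𝕂 c) :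
    (barB hc b : U 𝕂) = retraction hc (barU 𝕂 b) := rfl

lemma isBarInvolution_barB {c : Fin 2 → RatFunc 𝕂} (hc : IsParameter 𝕂 c) :
    IsBarInvolution 𝕂 c (barB hc) := by
  refine ⟨fun b hb => (retraction_barU_eq hc hb).1, fun i b hb => Subtype.ext ?_⟩
  rw [coe_barB, hb, retraction_barU_B]

lemma IsBarInvolution.eq {c : Fin 2 → RatFunc 𝕂} {φ ψ : Bc 𝕂 c ≃ₐ[𝕂] Bc 𝕂 c}
    (hφ : IsBarInvolution 𝕂 c φ) (hψ : IsBarInvolution 𝕂 c ψ) : φ = ψ := by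
  have hU : ∀ b : Bc 𝕂 c, (b : U 𝕂) ∈ UzeroTheta 𝕂 → φ b = ψ b := fun b hb =>
    Subtype.ext ((hφ.1 b hb).trans (hψ.1 b hb).symm)
  have key : ∀ (x : U 𝕂) (hx : x ∈ Bc 𝕂 c), φ ⟨x, hx⟩ = ψ ⟨x, hx⟩ := by
    intro x hx
    induction hx using Algebra.adjoin_induction with
    | mem x hx =>
      rcases hx with hx | ⟨i, rfl⟩
      · exact hU _ hx
      · rw [hφ.2 i _ rfl, hψ.2 i _ rfl]
    -- `φ` is only 𝕂-linear; its values on 𝕂(q) are fixed because these scalars lie in U⁰_Θ.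
    | algebraMap r => exact hU _ (Subalgebra.algebraMap_mem _ r)
    | add x y hx hy h1 h2 =>
      have h : (⟨x + y, add_mem hx hy⟩ : Bc 𝕂 c) = ⟨x, hx⟩ + ⟨y, hy⟩ := rfl
      rw [h, map_add, map_add, h1, h2]
    | mul x y hx hy h1 h2 =>
      have h : (⟨x * y, mul_mem hx hy⟩ : Bc 𝕂 c) = ⟨x, hx⟩ * ⟨y, hy⟩ := rfl
      rw [h, map_mul, map_mul, h1, h2]
  exact AlgEquiv.ext fun b => key b b.2

/-! ### The commutators of `Fᵢ` with the truncations of the explicit quasi K-matrix -/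

lemma qbrace_succ (n : ℕ) : qbrace 𝕂 (n + 1) = qbrace 𝕂 n + q 𝕂 ^ (2 * n) :=
  Finset.sum_range_succ _ _

lemma qbrace_succ' (n : ℕ) : qbrace 𝕂 (n + 1) = q 𝕂 ^ 2 * qbrace 𝕂 n + 1 := by
  rw [qbrace, Finset.sum_range_succ', qbrace, Finset.mul_sum]
  congr 1
  exact Finset.sum_congr rfl fun k _ => by ring

/-- Comparing the two recursions for {n+2} shows that {n+1} = 0 would force q^(2(n+1)) = 1. -/
lemma qbrace_succ_ne_zero (n : ℕ) : qbrace 𝕂 (n + 1) ≠ 0 := by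
  intro h
  apply q_pow_ne_one 𝕂 (n := 2 * (n + 1)) (by omega)
  have h1 := qbrace_succ (𝕂 := 𝕂) (n + 1)
  rw [qbrace_succ', h] at h1
  linear_combination -h1

lemma K_mul_E_pow (i : Fin 2) (n : ℕ) :
    (K 𝕂 i : U 𝕂) * E 𝕂 i ^ n = q 𝕂 ^ (2 * n) • (E 𝕂 i ^ n * (K 𝕂 i : U 𝕂)) := by
  induction n with
  | zero => simp
  | succ n ih =>
    have h := K_mul_E (𝕂 := 𝕂) i i
    simp only [cartan, if_true] at h
    rw [pow_succ, ← mul_assoc, ih, smul_mul_assoc, mul_assoc, h, mul_smul_comm, smul_smul,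
      mul_assoc]
    congr 1
    rw [mul_add, pow_add]
    rfl

lemma Kinv_mul_E_pow (i : Fin 2) (n : ℕ) :
    (((K 𝕂 i)⁻¹ : (U 𝕂)ˣ) : U 𝕂) * E 𝕂 i ^ n =
      (q 𝕂 ^ (2 * n))⁻¹ • (E 𝕂 i ^ n * (((K 𝕂 i)⁻¹ : (U 𝕂)ˣ) : U 𝕂)) := by
  have := K_mul_E_pow (𝕂 := 𝕂) i n
  rw [← zpow_natCast] at this ⊢
  rw [inv_mul_of_mul_eq this, zpow_neg]

/-- In the induction step the coefficient of K is collected by {n+2} = q²{n+1} + 1 and that of K⁻¹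
by {n+2} = {n+1} + q^(2(n+1)). -/
lemma F_mul_E_pow_succ (i : Fin 2) (n : ℕ) : F 𝕂 i * E 𝕂 i ^ (n + 1) =
    E 𝕂 i ^ (n + 1) * F 𝕂 i - (qbrace 𝕂 (n + 1) * (q 𝕂 - (q 𝕂)⁻¹)⁻¹) •
      (E 𝕂 i ^ n * ((K 𝕂 i : U 𝕂) - (q 𝕂 ^ (2 * n))⁻¹ • (((K 𝕂 i)⁻¹ : (U 𝕂)ˣ) : U 𝕂))) := by
  have hFE := E_F_same (𝕂 := 𝕂) i
  have hFE' : F 𝕂 i * E 𝕂 i = E 𝕂 i * F 𝕂 i -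
      (q 𝕂 - (q 𝕂)⁻¹)⁻¹ • ((K 𝕂 i : U 𝕂) - ((K 𝕂 i)⁻¹ : (U 𝕂)ˣ)) := by
    rw [← hFE, sub_sub_cancel]
  induction n with
  | zero => simp [hFE', qbrace]
  | succ n ih =>
    have h1 := K_mul_E_pow (𝕂 := 𝕂) i 1
    have h2 := Kinv_mul_E_pow (𝕂 := 𝕂) i 1
    rw [pow_one] at h1 h2
    rw [pow_succ _ (n + 1), ← mul_assoc, ih, sub_mul, mul_assoc, hFE', smul_mul_assoc, mul_assoc,
      sub_mul, h1, smul_mul_assoc, h2, mul_sub, ← mul_assoc, mul_sub (E 𝕂 i ^ n),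
      mul_smul_comm, mul_smul_comm, mul_smul_comm, mul_smul_comm, mul_sub, mul_sub, mul_smul_comm,
      ← mul_assoc, ← mul_assoc]
    simp only [← pow_succ]
    generalize E 𝕂 i ^ (n + 1) * (K 𝕂 i : U 𝕂) = x
    generalize E 𝕂 i ^ (n + 1) * (((K 𝕂 i)⁻¹ : (U 𝕂)ˣ) : U 𝕂) = y
    have hq : q 𝕂 ≠ 0 := q_ne_zero 𝕂
    have hx : (q 𝕂 - (q 𝕂)⁻¹)⁻¹ + qbrace 𝕂 (n + 1) * (q 𝕂 - (q 𝕂)⁻¹)⁻¹ * q 𝕂 ^ (2 * 1) =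
        qbrace 𝕂 (n + 1 + 1) * (q 𝕂 - (q 𝕂)⁻¹)⁻¹ := by
      rw [qbrace_succ' (n + 1)]; ring
    have hy : (q 𝕂 - (q 𝕂)⁻¹)⁻¹ + qbrace 𝕂 (n + 1) * (q 𝕂 - (q 𝕂)⁻¹)⁻¹ *
        (q 𝕂 ^ (2 * n))⁻¹ * (q 𝕂 ^ (2 * 1))⁻¹ =
        qbrace 𝕂 (n + 1 + 1) * (q 𝕂 - (q 𝕂)⁻¹)⁻¹ * (q 𝕂 ^ (2 * (n + 1)))⁻¹ := by
      rw [qbrace_succ (n + 1), mul_add 2 n 1, pow_add]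
      field_simp
      ring
    rw [smul_sub, smul_sub, smul_sub, smul_smul, smul_smul, smul_smul, smul_smul, ← hy, ← hx,
      add_smul, add_smul]
    abel

/-- The coefficient of `(E₁E₂)ⁿ` in the quasi K-matrix. -/
def quasiKCoeff (c : RatFunc 𝕂) (n : ℕ) : RatFunc 𝕂 :=
  (q 𝕂 - (q 𝕂)⁻¹) ^ n / qbraceFactorial 𝕂 n * c ^ n

@[simp] lemma quasiKCoeff_zero (c : RatFunc 𝕂) : quasiKCoeff c 0 = 1 := by
  simp [quasiKCoeff, qbraceFactorial]

/-- This recursion is what determines the coefficients: it matches the commutator of Fᵢ with the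
term of degree n+1 to the E-part of `B i` acting on the term of degree n. -/
lemma quasiKCoeff_succ (c : RatFunc 𝕂) (n : ℕ) :
    quasiKCoeff c (n + 1) * (qbrace 𝕂 (n + 1) * (q 𝕂 - (q 𝕂)⁻¹)⁻¹) = c * quasiKCoeff c n := by
  have h1 := qbrace_succ_ne_zero (𝕂 := 𝕂) n
  have h2 := q_sub_q_inv_ne_zero (𝕂 := 𝕂)
  have h3 : qbraceFactorial 𝕂 n ≠ 0 := Finset.prod_ne_zero_iff.2 fun k _ => qbrace_succ_ne_zero k
  have h4 : qbraceFactorial 𝕂 (n + 1) = qbraceFactorial 𝕂 n * qbrace 𝕂 (n + 1) :=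
    Finset.prod_range_succ _ _
  rw [quasiKCoeff, quasiKCoeff, h4]
  generalize q 𝕂 - (q 𝕂)⁻¹ = d at *
  field_simp
  ring

/-- The truncation `∑_{n < N}` of the explicit quasi K-matrix. -/
def quasiKTrunc (c : RatFunc 𝕂) (N : ℕ) : U 𝕂 :=
  ∑ n ∈ Finset.range N, quasiKCoeff c n • (E 𝕂 0 * E 𝕂 1) ^ n

lemma E_mul_E_pow (i : Fin 2) (n : ℕ) :
    (E 𝕂 0 * E 𝕂 1) ^ n = E 𝕂 i ^ n * E 𝕂 (tau i) ^ n := by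
  rw [(E_commute 0 1).mul_pow]
  fin_cases i
  · rfl
  · exact ((E_commute 0 1).pow_pow n n).eq

/-- E_τ(i) commutes with Fᵢ, so only the power of Eᵢ contributes. The factor q^(-2n) in
`F_mul_E_pow_succ` is absorbed by moving Kᵢ⁻¹ to the left of Eᵢⁿ, which produces the E-parts of `B
i` on the left and of its bar conjugate on the right. -/
lemma F_commutator_E_mul_E_pow_succ (i : Fin 2) (n : ℕ) :
    F 𝕂 i * (E 𝕂 0 * E 𝕂 1) ^ (n + 1) - (E 𝕂 0 * E 𝕂 1) ^ (n + 1) * F 𝕂 i =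
      (qbrace 𝕂 (n + 1) * (q 𝕂 - (q 𝕂)⁻¹)⁻¹) •
        (E 𝕂 (tau i) * (((K 𝕂 i)⁻¹ : (U 𝕂)ˣ) : U 𝕂) * (E 𝕂 0 * E 𝕂 1) ^ n -
          (E 𝕂 0 * E 𝕂 1) ^ n * (E 𝕂 (tau i) * (K 𝕂 i : U 𝕂))) := by
  have hEF : Commute (E 𝕂 (tau i) ^ (n + 1)) (F 𝕂 i) :=
    Commute.pow_left (E_F_ne (tau_ne i)) _
  have hEE : ∀ m k, E 𝕂 i ^ m * E 𝕂 (tau i) ^ k = E 𝕂 (tau i) ^ k * E 𝕂 i ^ m := fun m k =>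
    ((E_commute i (tau i)).pow_pow m k).eq
  have hcartan : cartan i (tau i) = 0 := by simp [cartan, (tau_ne i).symm]
  have hKE := K_mul_E (𝕂 := 𝕂) i (tau i)
  have hkE := Kinv_mul_E (𝕂 := 𝕂) i (tau i)
  rw [hcartan, zpow_zero, one_smul] at hKE
  rw [hcartan, neg_zero, zpow_zero, one_smul] at hkE
  have hkE' : Commute (((K 𝕂 i)⁻¹ : (U 𝕂)ˣ) : U 𝕂) (E 𝕂 (tau i) ^ n) :=
    Commute.pow_right hkE n
  have hl : E 𝕂 (tau i) * (((K 𝕂 i)⁻¹ : (U 𝕂)ˣ) : U 𝕂) * (E 𝕂 0 * E 𝕂 1) ^ n =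
      E 𝕂 (tau i) ^ (n + 1) * ((q 𝕂 ^ (2 * n))⁻¹ •
        (E 𝕂 i ^ n * (((K 𝕂 i)⁻¹ : (U 𝕂)ˣ) : U 𝕂))) := by
    rw [E_mul_E_pow i, hEE, mul_assoc, ← mul_assoc _ (E 𝕂 (tau i) ^ n), hkE'.eq, mul_assoc,
      Kinv_mul_E_pow, ← mul_assoc, ← pow_succ']
  have hr : (E 𝕂 0 * E 𝕂 1) ^ n * (E 𝕂 (tau i) * (K 𝕂 i : U 𝕂)) =
      E 𝕂 (tau i) ^ (n + 1) * (E 𝕂 i ^ n * (K 𝕂 i : U 𝕂)) := by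
    rw [E_mul_E_pow i, mul_assoc, ← mul_assoc _ (E 𝕂 (tau i)), ← pow_succ, ← mul_assoc, hEE,
      mul_assoc]
  rw [hl, hr, E_mul_E_pow i, hEE, mul_assoc, ← mul_assoc (F 𝕂 i), ← hEF.eq, mul_assoc,
    F_mul_E_pow_succ, ← mul_sub, sub_sub_cancel_left, ← mul_sub, mul_neg, mul_smul_comm,
    ← smul_neg, ← mul_neg, mul_sub (E 𝕂 i ^ n), neg_sub, mul_smul_comm]

/-- The constant term commutes with Fᵢ and the remaining degrees shift by one, whence N + 1 on one
side and N on the other. -/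
lemma F_commutator_quasiKTrunc (c : RatFunc 𝕂) (i : Fin 2) (N : ℕ) :
    F 𝕂 i * quasiKTrunc c (N + 1) - quasiKTrunc c (N + 1) * F 𝕂 i =
      c • (E 𝕂 (tau i) * (((K 𝕂 i)⁻¹ : (U 𝕂)ˣ) : U 𝕂) * quasiKTrunc c N -
          quasiKTrunc c N * (E 𝕂 (tau i) * (K 𝕂 i : U 𝕂))) := by
  rw [quasiKTrunc, Finset.sum_range_succ', mul_add, add_mul, pow_zero, mul_smul_comm,
    smul_mul_assoc, mul_one, one_mul, add_sub_add_right_eq_sub, Finset.mul_sum, Finset.sum_mul,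
    ← Finset.sum_sub_distrib, quasiKTrunc, Finset.mul_sum, Finset.sum_mul,
    ← Finset.sum_sub_distrib, Finset.smul_sum]
  refine Finset.sum_congr rfl fun n _ => ?_
  rw [mul_smul_comm, smul_mul_assoc, ← smul_sub, F_commutator_E_mul_E_pow_succ, smul_smul,
    quasiKCoeff_succ, mul_smul_comm, smul_mul_assoc, ← smul_sub, smul_smul]

/-! ### Existence of the quasi K-matrix -/

lemma E_mul_E_pow_mem (m : Fin 2 → ℕ) : E 𝕂 0 ^ m 0 * E 𝕂 1 ^ m 1 ∈ UposWt 𝕂 m := by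
  refine ⟨mul_mem (pow_mem (Algebra.subset_adjoin (Set.mem_range_self 0)) _)
    (pow_mem (Algebra.subset_adjoin (Set.mem_range_self 1)) _), fun i => ?_⟩
  have h : ∀ (j : Fin 2) (n : ℕ), (K 𝕂 i : U 𝕂) * E 𝕂 j ^ n =
      q 𝕂 ^ (cartan i j * n) • (E 𝕂 j ^ n * (K 𝕂 i : U 𝕂)) := by
    intro j n
    induction n with
    | zero => simp
    | succ n ih =>
      rw [pow_succ, ← mul_assoc, ih, smul_mul_assoc, mul_assoc, K_mul_E, mul_smul_comm, smul_smul,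
        ← zpow_add₀ (q_ne_zero 𝕂), mul_assoc]
      congr 2
      push_cast
      ring
  rw [← mul_assoc, h, smul_mul_assoc, mul_assoc _ (K 𝕂 i : U 𝕂), h, mul_smul_comm, smul_smul,
    ← zpow_add₀ (q_ne_zero 𝕂), smul_mul_assoc, mul_assoc, Units.mul_inv_cancel_right,
    Fin.sum_univ_two]

/-- The explicit quasi K-matrix. -/
def quasiK (c : RatFunc 𝕂) : Uhat 𝕂 := fun m =>
  ⟨if m 0 = m 1 then quasiKCoeff c (m 0) • (E 𝕂 0 * E 𝕂 1) ^ m 0 else 0, by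
    split_ifs with h
    · refine Submodule.smul_mem _ _ ?_
      have := E_mul_E_pow_mem (𝕂 := 𝕂) m
      rwa [← h, ← (E_commute 0 1).mul_pow] at this
    · exact zero_mem _⟩

lemma coe_quasiK (c : RatFunc 𝕂) (m : Fin 2 → ℕ) : (quasiK c m : U 𝕂) =
    if m 0 = m 1 then quasiKCoeff c (m 0) • (E 𝕂 0 * E 𝕂 1) ^ m 0 else 0 := rfl

lemma ofUhat_apply (a : Uhat 𝕂) (M : IntModule 𝕂) (v : M.carrier) :
    (ofUhat 𝕂 a : ∀ M : IntModule 𝕂, Module.End (RatFunc 𝕂) M.carrier) M v =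
      ∑ᶠ m, (a m : U 𝕂) • v := rfl

lemma Ucompl_ext {a b : Ucompl 𝕂} (h : ∀ (M : IntModule 𝕂) (v : M.carrier),
    (a : ∀ M : IntModule 𝕂, Module.End (RatFunc 𝕂) M.carrier) M v =
      (b : ∀ M : IntModule 𝕂, Module.End (RatFunc 𝕂) M.carrier) M v) : a = b :=
  Subtype.ext (funext fun M => LinearMap.ext (h M))

/-- The statement covers all N ≥ N₀, uniformly in v, because the commutator formula involves two
consecutive truncations. -/
lemma exists_quasiK_smul (c : RatFunc 𝕂) (M : IntModule 𝕂) : ∃ N₀ : ℕ, ∀ N ≥ N₀, ∀ v : M.carrier,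
    (ofUhat 𝕂 (quasiK c) : ∀ M : IntModule 𝕂, Module.End (RatFunc 𝕂) M.carrier) M v =
      quasiKTrunc c N • v := by
  obtain ⟨N₀, hN₀⟩ := ((finite_support_action 𝕂 M).image fun m => m 0).bddAbove
  refine ⟨N₀ + 1, fun N hN v => ?_⟩
  have hinj : Function.Injective fun (n : ℕ) (_ : Fin 2) => n := fun a b h => congrFun h 0
  rw [ofUhat_apply, finsum_eq_sum_of_support_subset
    (s := (Finset.range N).map ⟨fun (n : ℕ) (_ : Fin 2) => n, hinj⟩), Finset.sum_map,
    quasiKTrunc, Finset.sum_smul]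
  · simp [coe_quasiK]
  · intro m hm
    have hm0 : m 0 ≤ N₀ := hN₀ ⟨m, ⟨_, (quasiK c m).2, v, hm⟩, rfl⟩
    have hm1 : m 0 = m 1 := by
      by_contra h
      apply hm
      simp [coe_quasiK, h]
    simp only [Finset.coe_map, Set.mem_image, Finset.mem_coe, Finset.mem_range]
    refine ⟨m 0, by omega, funext fun i => ?_⟩
    fin_cases i
    · rfl
    · exact hm1

lemma L_commute_quasiKTrunc (c : RatFunc 𝕂) (N : ℕ) :
    Commute (L 𝕂 : U 𝕂) (quasiKTrunc c N) := by
  have h : Commute (L 𝕂 : U 𝕂) (E 𝕂 0 * E 𝕂 1) := by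
    rw [commute_iff_eq, ← mul_assoc, L_mul_E, smul_mul_assoc, mul_assoc, L_mul_E, mul_smul_comm,
      smul_smul, ← zpow_add₀ (q_ne_zero 𝕂), mul_assoc]
    simp [cartan]
  exact Commute.sum_right _ _ _ fun n _ => (h.pow_right n).smul_right _

lemma isQuasiKMatrix_quasiK {c : Fin 2 → RatFunc 𝕂} (hc : IsParameter 𝕂 c) :
    IsQuasiKMatrix 𝕂 c (barB hc) (quasiK (c 0)) := by
  refine ⟨by simp [coe_quasiK], ?_⟩
  rintro ⟨x, hx⟩
  simp only [coe_barB]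
  have hU : ∀ x ∈ UzeroTheta 𝕂, ofU 𝕂 (retraction hc (barU 𝕂 x)) * ofUhat 𝕂 (quasiK (c 0)) =
      ofUhat 𝕂 (quasiK (c 0)) * ofU 𝕂 (barU 𝕂 x) := by
    intro x hx
    induction hx using Algebra.adjoin_induction with
    | mem x hx =>
      obtain ⟨l, hl, rfl⟩ := hx
      rw [barU_Kroot hl, retraction_Kroot hc (Theta_neg hl), Kroot_eq_L_zpow (Theta_neg hl)]
      refine Ucompl_ext fun M v => ?_
      obtain ⟨N, hN⟩ := exists_quasiK_smul (c 0) M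
      change ((L 𝕂 ^ (-l) 0 : (U 𝕂)ˣ) : U 𝕂) •
        (ofUhat 𝕂 (quasiK (c 0)) : ∀ M : IntModule 𝕂, Module.End (RatFunc 𝕂) M.carrier) M v =
        (ofUhat 𝕂 (quasiK (c 0)) : ∀ M : IntModule 𝕂, Module.End (RatFunc 𝕂) M.carrier) M
          (((L 𝕂 ^ (-l) 0 : (U 𝕂)ˣ) : U 𝕂) • v)
      rw [hN N le_rfl, hN N le_rfl, smul_smul, smul_smul,
        ((L_commute_quasiKTrunc (c 0) N).units_zpow_left _).eq]
    | algebraMap r =>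
      simp only [barU_algebraMap, AlgHom.commutes]
      exact Algebra.commutes _ _
    | add x y _ _ h1 h2 => simp only [map_add, add_mul, mul_add, h1, h2]
    | mul x y _ _ h1 h2 => simp only [map_mul]; rw [mul_assoc, h2, ← mul_assoc, h1, mul_assoc]
  induction hx using Algebra.adjoin_induction with
  | mem x hx =>
    rcases hx with hx | ⟨i, rfl⟩
    · exact hU x hx
    · have hci : c 0 = c i := by
        fin_cases i
        · rfl
        · simpa [tau] using hc.tau_eq 0
      rw [retraction_barU_B, barU_B hc]
      refine Ucompl_ext fun M v => ?_
      obtain ⟨N, hN⟩ := exists_quasiK_smul (c 0) M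
      change B 𝕂 c i •
        (ofUhat 𝕂 (quasiK (c 0)) : ∀ M : IntModule 𝕂, Module.End (RatFunc 𝕂) M.carrier) M v =
        (ofUhat 𝕂 (quasiK (c 0)) : ∀ M : IntModule 𝕂, Module.End (RatFunc 𝕂) M.carrier) M
          ((F 𝕂 i - c i • (E 𝕂 (tau i) * (K 𝕂 i : U 𝕂))) • v)
      -- The truncations at N and at N + 1 both act on M as 𝔛, so this identity is a rearrangement
      -- of the goal.
      have h := congrArg (fun x : U 𝕂 => x • v) (F_commutator_quasiKTrunc (c 0) i N)
      rw [hci] at h hN ⊢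
      simp only [sub_smul, smul_assoc, mul_smul, smul_sub, B, ← hN N le_rfl,
        ← hN (N + 1) (Nat.le_succ N)] at h ⊢
      rw [map_sub, LinearMap.map_smul, sub_eq_sub_iff_sub_eq_sub]
      exact h
  | algebraMap r => exact hU _ (Subalgebra.algebraMap_mem _ r)
  | add x y _ _ h1 h2 => simp only [map_add, add_mul, mul_add, h1, h2]
  | mul x y _ _ h1 h2 => simp only [map_mul]; rw [mul_assoc, h2, ← mul_assoc, h1, mul_assoc]

/-! ### Modules of functions on the root lattice -/

/-- The quantum integer `[n]`. -/
def qnum (𝕂 : Type u) [Field 𝕂] (n : ℤ) : RatFunc 𝕂 :=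
  (q 𝕂 ^ n - q 𝕂 ^ (-n)) / (q 𝕂 - (q 𝕂)⁻¹)

@[simp] lemma qnum_zero : qnum 𝕂 0 = 0 := by simp [qnum]

lemma qnum_ne_zero {n : ℤ} (hn : n ≠ 0) : qnum 𝕂 n ≠ 0 := by
  refine div_ne_zero (fun h => hn ?_) q_sub_q_inv_ne_zero
  have := q_zpow_injective 𝕂 (sub_eq_zero.1 h)
  omega

/-- The right-hand side is [a - b]. With a = xᵢ and b = N - xᵢ this is the relation for EᵢFᵢ - FᵢEᵢ
on functions. -/
lemma qnum_mul_sub (a b : ℤ) : qnum 𝕂 a * qnum 𝕂 (b + 1) - qnum 𝕂 (a + 1) * qnum 𝕂 b =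
    (q 𝕂 - (q 𝕂)⁻¹)⁻¹ * (q 𝕂 ^ (a - b) - (q 𝕂 ^ (a - b))⁻¹) := by
  have hq : q 𝕂 ≠ 0 := q_ne_zero 𝕂
  have hd := q_sub_q_inv_ne_zero (𝕂 := 𝕂)
  have ha := zpow_ne_zero a hq
  have hb := zpow_ne_zero b hq
  have key : (q 𝕂 ^ a - (q 𝕂 ^ a)⁻¹) * (q 𝕂 ^ b * q 𝕂 - (q 𝕂 ^ b * q 𝕂)⁻¹) -
      (q 𝕂 ^ a * q 𝕂 - (q 𝕂 ^ a * q 𝕂)⁻¹) * (q 𝕂 ^ b - (q 𝕂 ^ b)⁻¹) =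
      (q 𝕂 - (q 𝕂)⁻¹) * (q 𝕂 ^ a / q 𝕂 ^ b - (q 𝕂 ^ a / q 𝕂 ^ b)⁻¹) := by
    field_simp
    ring
  simp only [qnum, zpow_neg, zpow_add₀ hq, zpow_sub₀ hq, zpow_one]
  rw [div_mul_div_comm, div_mul_div_comm, ← sub_div, key, mul_div_mul_left _ _ hd, inv_mul_eq_div]

/-- The functions on the root lattice, as the underlying space of a `U`-module depending on `N`. -/
def LatticeFun (𝕂 : Type u) [Field 𝕂] (_N : ℤ) : Type u := (Fin 2 → ℤ) → RatFunc 𝕂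

instance : AddCommGroup (LatticeFun 𝕂 N) := inferInstanceAs (AddCommGroup ((Fin 2 → ℤ) → RatFunc 𝕂))

instance : Module (RatFunc 𝕂) (LatticeFun 𝕂 N) :=
  inferInstanceAs (Module (RatFunc 𝕂) ((Fin 2 → ℤ) → RatFunc 𝕂))

/-- The simple root `αᵢ`. -/
abbrev simpleRoot (i : Fin 2) : Fin 2 → ℤ := Pi.single i 1

/-- The action of the generators on functions. -/
def latticeGen (𝕂 : Type u) [Field 𝕂] (N : ℤ) :
    Gen → Module.End (RatFunc 𝕂) (LatticeFun 𝕂 N)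
  | .E i =>
    { toFun := fun f x => qnum 𝕂 (N - x i + 1) * f (x - simpleRoot i)
      map_add' := fun _ _ => funext fun _ => mul_add _ _ _
      map_smul' := fun _ _ => funext fun _ => mul_left_comm _ _ _ }
  | .F i =>
    { toFun := fun f x => qnum 𝕂 (x i + 1) * f (x + simpleRoot i)
      map_add' := fun _ _ => funext fun _ => mul_add _ _ _
      map_smul' := fun _ _ => funext fun _ => mul_left_comm _ _ _ }
  | .K i =>
    { toFun := fun f x => q 𝕂 ^ (2 * x i - N) * f x
      map_add' := fun _ _ => funext fun _ => mul_add _ _ _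
      map_smul' := fun _ _ => funext fun _ => mul_left_comm _ _ _ }
  | .Kinv i =>
    { toFun := fun f x => (q 𝕂 ^ (2 * x i - N))⁻¹ * f x
      map_add' := fun _ _ => funext fun _ => mul_add _ _ _
      map_smul' := fun _ _ => funext fun _ => mul_left_comm _ _ _ }

section latticeGen

variable (i : Fin 2) (f g : LatticeFun 𝕂 N) (x : Fin 2 → ℤ) (r : RatFunc 𝕂)

lemma latticeGen_E : latticeGen 𝕂 N (.E i) f x =
    qnum 𝕂 (N - x i + 1) * f (x - simpleRoot i) := rfl

lemma latticeGen_F : latticeGen 𝕂 N (.F i) f x = qnum 𝕂 (x i + 1) * f (x + simpleRoot i) := rfl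

lemma latticeGen_K : latticeGen 𝕂 N (.K i) f x = q 𝕂 ^ (2 * x i - N) * f x := rfl

lemma latticeGen_Kinv : latticeGen 𝕂 N (.Kinv i) f x = (q 𝕂 ^ (2 * x i - N))⁻¹ * f x := rfl

lemma LatticeFun.sub_apply : (f - g) x = f x - g x := rfl

lemma LatticeFun.add_apply : (f + g) x = f x + g x := rfl

lemma LatticeFun.smul_apply : (r • f) x = r * f x := rfl

end latticeGen

/-- The relations hold on functions on the whole lattice, so no boundary cases occur;
finite-dimensionality is obtained afterwards by passing to a submodule. -/
lemma lattice_rel ⦃x y : Free 𝕂⦄ (h : Rel 𝕂 x y) :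
    FreeAlgebra.lift (RatFunc 𝕂) (latticeGen 𝕂 N) x =
      FreeAlgebra.lift (RatFunc 𝕂) (latticeGen 𝕂 N) y := by
  have hq : q 𝕂 ≠ 0 := q_ne_zero 𝕂
  have hz : ∀ n : ℤ, q 𝕂 ^ n ≠ 0 := fun n => zpow_ne_zero n hq
  refine LinearMap.ext fun f => funext fun x => ?_
  cases h with
  | K_mul_Kinv i =>
    simp only [map_mul, map_one, FreeAlgebra.lift_ι_apply, Module.End.mul_apply, latticeGen_K,
      latticeGen_Kinv, Module.End.one_apply, mul_inv_cancel_left₀ (hz _)]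
  | Kinv_mul_K i =>
    simp only [map_mul, map_one, FreeAlgebra.lift_ι_apply, Module.End.mul_apply, latticeGen_K,
      latticeGen_Kinv, Module.End.one_apply, inv_mul_cancel_left₀ (hz _)]
  | K_comm i j =>
    simp only [map_mul, FreeAlgebra.lift_ι_apply, Module.End.mul_apply, latticeGen_K]
    exact mul_left_comm _ _ _
  | K_E i j =>
    simp only [map_mul, map_smul, FreeAlgebra.lift_ι_apply, Module.End.mul_apply,
      LinearMap.smul_apply, latticeGen_K, latticeGen_Kinv, latticeGen_E, LatticeFun.smul_apply]
    have : q 𝕂 ^ (2 * x i - N) =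
        q 𝕂 ^ cartan i j * q 𝕂 ^ (2 * (x - simpleRoot j) i - N) := by
      rw [← zpow_add₀ hq]
      congr 1
      by_cases h : i = j
      · subst h; simp [cartan]; ring
      · simp [cartan, h]
    rw [this]
    have := hz (2 * (x - simpleRoot j) i - N)
    field_simp
  | K_F i j =>
    simp only [map_mul, map_smul, FreeAlgebra.lift_ι_apply, Module.End.mul_apply,
      LinearMap.smul_apply, latticeGen_K, latticeGen_Kinv, latticeGen_F, LatticeFun.smul_apply]
    have : q 𝕂 ^ (2 * x i - N) =
        q 𝕂 ^ (-cartan i j) * q 𝕂 ^ (2 * (x + simpleRoot j) i - N) := by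
      rw [← zpow_add₀ hq]
      congr 1
      by_cases h : i = j
      · subst h; simp [cartan]; ring
      · simp [cartan, h]
    rw [this]
    have := hz (2 * (x + simpleRoot j) i - N)
    field_simp
  | E_F_same i =>
    simp only [map_mul, map_smul, map_sub, FreeAlgebra.lift_ι_apply, Module.End.mul_apply,
      LinearMap.smul_apply, LinearMap.sub_apply, latticeGen_K, latticeGen_Kinv, latticeGen_E,
      latticeGen_F, LatticeFun.smul_apply, LatticeFun.sub_apply, sub_add_cancel,
      add_sub_cancel_right, Pi.sub_apply, Pi.add_apply, Pi.single_eq_same]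
    have h := qnum_mul_sub (𝕂 := 𝕂) (x i) (N - x i)
    have e1 : N - (x i + 1) + 1 = N - x i := by ring
    have e2 : x i - (N - x i) = 2 * x i - N := by ring
    rw [e2] at h
    rw [e1]
    linear_combination f x * h
  | E_F_ne i j hij =>
    have e : x - simpleRoot i + simpleRoot j = x + simpleRoot j - simpleRoot i := by abel
    simp only [map_mul, map_sub, map_zero, FreeAlgebra.lift_ι_apply, Module.End.mul_apply,
      LinearMap.sub_apply, latticeGen_E, latticeGen_F, LatticeFun.sub_apply, Pi.sub_apply,
      Pi.add_apply, Pi.single_eq_of_ne hij, Pi.single_eq_of_ne hij.symm, sub_zero, add_zero, e]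
    exact sub_eq_zero.2 (mul_left_comm _ _ _)
  | serre_E i j hij =>
    have e : x - simpleRoot i - simpleRoot j = x - simpleRoot j - simpleRoot i := by abel
    simp only [map_mul, map_sub, map_zero, FreeAlgebra.lift_ι_apply, Module.End.mul_apply,
      LinearMap.sub_apply, latticeGen_E, LatticeFun.sub_apply, Pi.sub_apply,
      Pi.single_eq_of_ne hij, Pi.single_eq_of_ne hij.symm, sub_zero, e]
    exact sub_eq_zero.2 (mul_left_comm _ _ _)
  | serre_F i j hij =>
    have e : x + simpleRoot i + simpleRoot j = x + simpleRoot j + simpleRoot i := by abel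
    simp only [map_mul, map_sub, map_zero, FreeAlgebra.lift_ι_apply, Module.End.mul_apply,
      LinearMap.sub_apply, latticeGen_F, LatticeFun.sub_apply,
      Pi.add_apply, Pi.single_eq_of_ne hij, Pi.single_eq_of_ne hij.symm, add_zero, e]
    exact sub_eq_zero.2 (mul_left_comm _ _ _)

/-- The representation of `U` on functions. -/
def latticeRep (𝕂 : Type u) [Field 𝕂] (N : ℤ) :
    U 𝕂 →ₐ[RatFunc 𝕂] Module.End (RatFunc 𝕂) (LatticeFun 𝕂 N) :=
  liftU 𝕂 (FreeAlgebra.lift (RatFunc 𝕂) (latticeGen 𝕂 N)) lattice_rel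

instance : Module (U 𝕂) (LatticeFun 𝕂 N) :=
  Module.compHom _ (latticeRep 𝕂 N : U 𝕂 →+* Module.End (RatFunc 𝕂) (LatticeFun 𝕂 N))

instance : IsScalarTower (RatFunc 𝕂) (U 𝕂) (LatticeFun 𝕂 N) where
  smul_assoc r x f := by
    change latticeRep 𝕂 N (r • x) f = r • latticeRep 𝕂 N x f
    rw [map_smul, LinearMap.smul_apply]

lemma ofGen_smul (g : Gen) (f : LatticeFun 𝕂 N) : ofGen 𝕂 g • f = latticeGen 𝕂 N g f := by
  change latticeRep 𝕂 N (ofGen 𝕂 g) f = _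
  rw [show latticeRep 𝕂 N (ofGen 𝕂 g) = latticeGen 𝕂 N g from
    (liftU_proj 𝕂 _ lattice_rel (gen 𝕂 g)).trans (FreeAlgebra.lift_ι_apply _ _)]

/-- The functions supported on the box `[0, N]²`. -/
def boxModule (𝕂 : Type u) [Field 𝕂] (N : ℤ) : Submodule (U 𝕂) (LatticeFun 𝕂 N) where
  carrier := {f | ∀ x : Fin 2 → ℤ, f x ≠ 0 → ∀ i, 0 ≤ x i ∧ x i ≤ N}
  zero_mem' := fun x hx => (hx rfl).elim
  add_mem' := by
    intro f g hf hg x hx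
    by_cases h : f x = 0
    · exact hg x fun h' => hx (by rw [LatticeFun.add_apply, h, h', add_zero])
    · exact hf x h
  smul_mem' := by
    intro u
    obtain ⟨a, rfl⟩ := RingQuot.mkAlgHom_surjective (RatFunc 𝕂) (Rel 𝕂) u
    change ∀ {f : LatticeFun 𝕂 N}, f ∈ {f | _} → proj 𝕂 a • f ∈ _
    induction a using FreeAlgebra.induction with
    | grade0 r =>
      intro f hf x hx
      rw [AlgHom.commutes, algebraMap_smul] at hx
      exact hf x (right_ne_zero_of_mul hx)
    | grade1 g =>
      intro f hf x hx
      change (ofGen 𝕂 g • f) x ≠ 0 at hx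
      rw [ofGen_smul] at hx
      cases g with
      | E i =>
        rw [latticeGen_E] at hx
        have h2 := hf _ (right_ne_zero_of_mul hx)
        -- The coefficient of Eᵢ vanishes at xᵢ = N + 1, the only place where it could leave the
        -- box.
        have h1 : N - x i + 1 ≠ 0 := fun h => left_ne_zero_of_mul hx (by rw [h, qnum_zero])
        intro j
        have := h2 j
        by_cases hj : j = i
        · subst hj
          simp at this
          omega
        · simpa [hj] using this
      | F i =>
        rw [latticeGen_F] at hx
        have h2 := hf _ (right_ne_zero_of_mul hx)
        -- Likewise the coefficient of Fᵢ vanishes at xᵢ = -1.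
        have h1 : x i + 1 ≠ 0 := fun h => left_ne_zero_of_mul hx (by rw [h, qnum_zero])
        intro j
        have := h2 j
        by_cases hj : j = i
        · subst hj
          simp at this
          omega
        · simpa [hj] using this
      | K i => exact hf x (right_ne_zero_of_mul hx)
      | Kinv i => exact hf x (right_ne_zero_of_mul hx)
    | mul a b ha hb =>
      intro f hf
      rw [map_mul, mul_smul]
      exact ha (hb hf)
    | add a b ha hb =>
      intro f hf x hx
      rw [map_add, add_smul, LatticeFun.add_apply] at hx
      by_cases h : (proj 𝕂 a • f) x = 0
      · exact hb hf x fun h' => hx (by rw [h, h', add_zero])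
      · exact ha hf x h

/-- The function with value `r` at `x` which vanishes elsewhere. -/
def latticeSingle (N : ℤ) (x : Fin 2 → ℤ) (r : RatFunc 𝕂) : LatticeFun 𝕂 N :=
  fun y => if y = x then r else 0

lemma latticeSingle_mem {x : Fin 2 → ℤ} (hx : ∀ i, 0 ≤ x i ∧ x i ≤ N) (r : RatFunc 𝕂) :
    latticeSingle N x r ∈ boxModule 𝕂 N := by
  intro y hy
  by_cases h : y = x
  · rwa [h]
  · exact (hy (if_neg h)).elim

/-- Evaluation at a point of the root lattice. -/
def boxEval (𝕂 : Type u) [Field 𝕂] (N : ℤ) (x : Fin 2 → ℤ) :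
    boxModule 𝕂 N →ₗ[RatFunc 𝕂] RatFunc 𝕂 where
  toFun f := (f : LatticeFun 𝕂 N) x
  map_add' _ _ := rfl
  map_smul' _ _ := rfl

lemma boxModule_ext {f g : boxModule 𝕂 N} (h : ∀ x, boxEval 𝕂 N x f = boxEval 𝕂 N x g) : f = g :=
  Subtype.ext (funext h)

instance : Module.Finite (RatFunc 𝕂) (boxModule 𝕂 N) := by
  let s : Finset (Fin 2 → ℤ) := Finset.Icc 0 (fun _ => N)
  refine Module.Finite.of_injective (LinearMap.pi fun x : s => boxEval 𝕂 N x)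
    fun f g h => boxModule_ext fun x => ?_
  by_cases hx : x ∈ s
  · exact congrFun h ⟨x, hx⟩
  · have h0 : ∀ f : boxModule 𝕂 N, boxEval 𝕂 N x f = 0 := by
      intro f
      by_contra hf
      have := f.2 x hf
      exact hx (Finset.mem_Icc.2 ⟨fun i => (this i).1, fun i => (this i).2⟩)
    rw [h0, h0]

/-- The tensor product of two simple modules of highest weight `N`, as an object of `𝒪_int`. -/
abbrev boxIntModule (𝕂 : Type u) [Field 𝕂] (N : ℤ) : IntModule 𝕂 where
  carrier := boxModule 𝕂 N
  type_one := by
    rw [eq_top_iff]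
    rintro ⟨f, hf⟩ -
    have hmem : ∀ x : {x // x ∈ Finset.Icc (0 : Fin 2 → ℤ) (fun _ => N)},
        ∀ i, 0 ≤ x.1 i ∧ x.1 i ≤ N := fun x i =>
      ⟨(Finset.mem_Icc.1 x.2).1 i, (Finset.mem_Icc.1 x.2).2 i⟩
    have hsum : (⟨f, hf⟩ : boxModule 𝕂 N) = ∑ x ∈ (Finset.Icc 0 (fun _ => N)).attach,
        ⟨latticeSingle N x.1 (f x.1), latticeSingle_mem (hmem x) _⟩ := by
      refine boxModule_ext fun y => ?_
      rw [map_sum]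
      change f y = ∑ x ∈ (Finset.Icc 0 (fun _ => N)).attach, if y = x.1 then f x.1 else 0
      by_cases h : f y = 0
      · rw [h, Finset.sum_eq_zero]
        intro x _
        split_ifs with hx
        · rw [← hx, h]
        · rfl
      · have hy : y ∈ Finset.Icc (0 : Fin 2 → ℤ) (fun _ => N) :=
          Finset.mem_Icc.2 ⟨fun i => (hf y h i).1, fun i => (hf y h i).2⟩
        rw [Finset.sum_eq_single ⟨y, hy⟩, if_pos rfl]
        · exact fun x _ hx => if_neg fun h => hx (Subtype.ext h.symm)
        · exact fun h => (h (Finset.mem_attach _ _)).elim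
    rw [hsum]
    -- The point mass at x is a weight vector of weight 2xᵢ - N.
    refine Submodule.sum_mem _ fun x _ => Submodule.mem_iSup_of_mem (fun i => 2 * x.1 i - N) ?_
    intro i
    refine boxModule_ext fun y => ?_
    change (ofGen 𝕂 (.K i) • latticeSingle N x.1 (f x.1)) y =
      q 𝕂 ^ (2 * x.1 i - N) * latticeSingle N x.1 (f x.1) y
    rw [ofGen_smul, latticeGen_K]
    by_cases h : y = x.1
    · rw [h]
    · rw [latticeSingle, if_neg h, mul_zero, mul_zero]

/-! ### The weight spaces of `U⁺` -/

/-- The monomial of weight `m` in `U⁺`. -/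
def monomial (𝕂 : Type u) [Field 𝕂] (m : Fin 2 → ℕ) : U 𝕂 := E 𝕂 0 ^ m 0 * E 𝕂 1 ^ m 1

lemma E_commute_monomial (i : Fin 2) (m : Fin 2 → ℕ) : Commute (E 𝕂 i) (monomial 𝕂 m) :=
  ((E_commute i 0).pow_right _).mul_right ((E_commute i 1).pow_right _)

lemma monomial_mul (m n : Fin 2 → ℕ) :
    monomial 𝕂 m * monomial 𝕂 n = monomial 𝕂 (m + n) := by
  simp only [monomial, Pi.add_apply, pow_add]
  exact (((E_commute 1 0).pow_pow _ _).mul_mul_mul_comm _ _)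

lemma exists_finsupp_of_mem_Upos {x : U 𝕂} (hx : x ∈ Upos 𝕂) :
    ∃ s : (Fin 2 → ℕ) →₀ RatFunc 𝕂, s.sum (fun m r => r • monomial 𝕂 m) = x := by
  rw [← Finsupp.mem_span_range_iff_exists_finsupp]
  rw [Upos, ← Subalgebra.mem_toSubmodule, Algebra.adjoin_eq_span] at hx
  refine Submodule.span_mono ?_ hx
  intro y hy
  induction hy using Submonoid.closure_induction with
  | mem y hy =>
    obtain ⟨i, rfl⟩ := hy
    refine ⟨Pi.single i 1, ?_⟩
    fin_cases i <;> simp [monomial]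
  | one => exact ⟨0, by simp [monomial]⟩
  | mul y z _ _ hy hz =>
    obtain ⟨m, rfl⟩ := hy
    obtain ⟨n, rfl⟩ := hz
    exact ⟨m + n, (monomial_mul m n).symm⟩

lemma latticeSingle_apply (x y : Fin 2 → ℤ) (r : RatFunc 𝕂) :
    latticeSingle N x r y = if y = x then r else 0 := rfl

lemma E_smul_latticeSingle (i : Fin 2) (x : Fin 2 → ℤ) (r : RatFunc 𝕂) :
    E 𝕂 i • latticeSingle N x r =
      latticeSingle N (x + simpleRoot i) (qnum 𝕂 (N - x i) * r) := by
  rw [ofGen_smul]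
  funext y
  rw [latticeGen_E, latticeSingle_apply, latticeSingle_apply]
  by_cases h : y = x + simpleRoot i
  · rw [h, if_pos (add_sub_cancel_right _ _), if_pos rfl]
    congr 2
    simp only [Pi.add_apply, Pi.single_eq_same]
    ring
  · rw [if_neg h, if_neg fun h' => h (by rw [← h', sub_add_cancel]), mul_zero]

/-- The scalar picks up the factors [N - xᵢ - k] for k < n, all non-zero while the point mass stays
at or below N. -/
lemma E_pow_smul_latticeSingle (i : Fin 2) (n : ℕ) (x : Fin 2 → ℤ) (r : RatFunc 𝕂) :
    ∃ r', E 𝕂 i ^ n • latticeSingle N x r = latticeSingle N (x + n • simpleRoot i) r' ∧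
      (r ≠ 0 → x i + n ≤ N → r' ≠ 0) := by
  induction n with
  | zero => exact ⟨r, by simp, fun h _ => h⟩
  | succ n ih =>
    obtain ⟨r', h1, h2⟩ := ih
    refine ⟨qnum 𝕂 (N - (x + n • simpleRoot i) i) * r', ?_, fun h h' => ?_⟩
    · rw [pow_succ', mul_smul, h1, E_smul_latticeSingle, succ_nsmul, add_assoc]
    · push_cast at h'
      refine mul_ne_zero (qnum_ne_zero ?_) (h2 h (by omega))
      simp
      omega

lemma monomial_smul_latticeSingle (m : Fin 2 → ℕ) :
    ∃ r : RatFunc 𝕂, monomial 𝕂 m • latticeSingle N 0 1 = latticeSingle N (fun i => (m i : ℤ)) r ∧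
      ((∀ i, (m i : ℤ) ≤ N) → r ≠ 0) := by
  obtain ⟨r, h1, h2⟩ := E_pow_smul_latticeSingle (𝕂 := 𝕂) (N := N) 1 (m 1) 0 1
  obtain ⟨r', h1', h2'⟩ := E_pow_smul_latticeSingle (𝕂 := 𝕂) (N := N) 0 (m 0)
    (0 + m 1 • simpleRoot 1) r
  refine ⟨r', ?_, fun h => h2' (h2 one_ne_zero ?_) ?_⟩
  · rw [monomial, mul_smul, h1, h1']
    congr 1
    funext i
    fin_cases i <;> simp
  · simpa using h 1
  · simpa using h 0

lemma K_smul_latticeSingle (i : Fin 2) (x : Fin 2 → ℤ) (r : RatFunc 𝕂) :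
    (K 𝕂 i : U 𝕂) • latticeSingle N x r = q 𝕂 ^ (2 * x i - N) • latticeSingle N x r := by
  rw [K_val, ofGen_smul]
  funext y
  rw [latticeGen_K, LatticeFun.smul_apply, latticeSingle_apply]
  by_cases h : y = x
  · rw [h]
  · rw [if_neg h, mul_zero, mul_zero]

/-- Instead of a PBW basis, the action on functions is used: on the point mass at 0 distinct
monomials yield point masses at distinct points, and comparing Kᵢ-eigenvalues there excludes every
monomial except that of weight m. -/
lemma exists_eq_smul_monomial {m : Fin 2 → ℕ} {x : U 𝕂} (hx : x ∈ UposWt 𝕂 m) :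
    ∃ r : RatFunc 𝕂, x = r • monomial 𝕂 m := by
  obtain ⟨s, hs⟩ := exists_finsupp_of_mem_Upos hx.1
  refine ⟨s m, ?_⟩
  suffices h : ∀ y ∈ s.support, y = m by
    rw [← hs, Finsupp.sum]
    refine Finset.sum_eq_single m (fun y hy hym => (hym (h y hy)).elim) fun h => ?_
    rw [Finsupp.notMem_support_iff.1 h, zero_smul]
  intro y hy
  -- This N bounds both exponents of every monomial that occurs, so none of them kills the point
  -- mass.
  let N : ℤ := (s.support.sup fun y => y 0 + y 1 : ℕ)
  have hN : ∀ i, (y i : ℤ) ≤ N := by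
    have := Finset.le_sup (f := fun y : Fin 2 → ℕ => y 0 + y 1) hy
    intro i
    have hi : y i ≤ y 0 + y 1 := by fin_cases i <;> simp
    exact Int.ofNat_le.2 (hi.trans this)
  let v : LatticeFun 𝕂 N := latticeSingle N 0 1
  have hval : (x • v) (fun i => (y i : ℤ)) ≠ 0 := by
    choose r hr hr' using monomial_smul_latticeSingle (𝕂 := 𝕂) (N := N)
    have : x • v = ∑ n ∈ s.support, s n • latticeSingle N (fun i => (n i : ℤ)) (r n) := by
      rw [← hs, Finsupp.sum, Finset.sum_smul]
      exact Finset.sum_congr rfl fun n _ => by rw [smul_assoc, hr]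
    let ev : LatticeFun 𝕂 N →+ RatFunc 𝕂 :=
      { toFun := fun f => f (fun i => (y i : ℤ))
        map_zero' := rfl
        map_add' := fun _ _ => rfl }
    replace this := congrArg ev this
    rw [map_sum] at this
    change ev (x • v) ≠ 0
    rw [this, Finset.sum_eq_single y]
    · change s y * latticeSingle N _ (r y) _ ≠ 0
      rw [latticeSingle_apply, if_pos rfl]
      exact mul_ne_zero (Finsupp.mem_support_iff.1 hy) (hr' y hN)
    · intro n _ hn
      change s n * latticeSingle N _ (r n) _ = 0
      rw [latticeSingle_apply, if_neg, mul_zero]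
      exact fun h => hn (funext fun i => by exact_mod_cast (congrFun h i).symm)
    · exact fun h => (h hy).elim
  funext i
  -- The vector v has weight -N, and x raises it by 2mᵢ.
  have hK : (K 𝕂 i : U 𝕂) • x • v = q 𝕂 ^ (2 * (m i : ℤ) - N) • x • v := by
    have h1 : (K 𝕂 i : U 𝕂) * x = (q 𝕂 ^ (∑ j, cartan i j * (m j : ℤ)) • x) * (K 𝕂 i : U 𝕂) := by
      rw [← hx.2 i]
      simp [mul_assoc]
    have h2 : ∑ j, cartan i j * (m j : ℤ) = 2 * m i := by
      fin_cases i <;> simp [cartan]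
    have h3 : x • (q 𝕂 ^ (2 * (0 : Fin 2 → ℤ) i - N) • v) =
        q 𝕂 ^ (2 * (0 : Fin 2 → ℤ) i - N) • x • v := by
      rw [← algebraMap_smul (U 𝕂) _ v, smul_smul, ← Algebra.commutes, mul_smul, algebraMap_smul]
    rw [smul_smul, h1, mul_smul, K_smul_latticeSingle, smul_assoc, h3, smul_smul, h2,
      ← zpow_add₀ (q_ne_zero 𝕂)]
    congr 2
    simp
    ring
  -- At the point y the element Kᵢ multiplies by q^(2yᵢ - N), and the value there is non-zero.
  have hK' := congrFun hK (fun i => (y i : ℤ))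
  rw [K_val, ofGen_smul, latticeGen_K, LatticeFun.smul_apply] at hK'
  have := q_zpow_injective 𝕂 (mul_right_cancel₀ hval hK')
  omega

/-! ### Uniqueness of the quasi K-matrix -/

/-- The lowest weight vector of `boxIntModule 𝕂 N`. -/
def boxLowest (𝕂 : Type u) [Field 𝕂] (N : ℕ) : (boxIntModule 𝕂 N).carrier :=
  ⟨latticeSingle N 0 1, latticeSingle_mem (fun i => by simp) 1⟩

/-- The values of the image of the lowest weight vector of `boxIntModule 𝕂 N` under `a`. -/
def lowestImage (N : ℕ) (a : Uhat 𝕂) (x : Fin 2 → ℤ) : RatFunc 𝕂 :=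
  boxEval 𝕂 N x
    ((ofUhat 𝕂 a : ∀ M : IntModule 𝕂, Module.End (RatFunc 𝕂) M.carrier) (boxIntModule 𝕂 N)
      (boxLowest 𝕂 N))

lemma lowestImage_of_neg (N : ℕ) (a : Uhat 𝕂) {x : Fin 2 → ℤ} {i : Fin 2} (hx : x i < 0) :
    lowestImage N a x = 0 := by
  by_contra h
  have := ((((ofUhat 𝕂 a : ∀ M : IntModule 𝕂, Module.End (RatFunc 𝕂) M.carrier)
    (boxIntModule 𝕂 N) (boxLowest 𝕂 N)) : boxModule 𝕂 N).2 x h i).1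
  omega

/-- The component of weight n moves the point mass at 0 to n, so only the component of weight m is
seen at m. -/
lemma lowestImage_natCast (N : ℕ) (a : Uhat 𝕂) (m : Fin 2 → ℕ) :
    lowestImage N a (fun i => (m i : ℤ)) =
      ((a m : U 𝕂) • latticeSingle (N : ℤ) 0 1) (fun i => (m i : ℤ)) := by
  rw [lowestImage, ofUhat_apply]
  have := AddMonoidHom.map_finsum (boxEval 𝕂 N (fun i => (m i : ℤ))).toAddMonoidHom
    (finite_support_smul 𝕂 (boxIntModule 𝕂 N) a (boxLowest 𝕂 N))
  refine this.trans (finsum_eq_single _ m fun n hn => ?_)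
  obtain ⟨k, hk⟩ := exists_eq_smul_monomial (a n).2
  obtain ⟨r, hr, -⟩ := monomial_smul_latticeSingle (𝕂 := 𝕂) (N := N) n
  change ((a n : U 𝕂) • latticeSingle (N : ℤ) 0 (1 : RatFunc 𝕂)) (fun i => (m i : ℤ)) = 0
  rw [hk, smul_assoc, hr, LatticeFun.smul_apply, latticeSingle_apply, if_neg, mul_zero]
  exact fun h => hn (funext fun i => by exact_mod_cast (congrFun h i).symm)

/-- U⁺ is commutative here, as E₁ and E₂ commute. -/
lemma ofUhat_E_smul (a : Uhat 𝕂) (M : IntModule 𝕂) (i : Fin 2) (v : M.carrier) :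
    (ofUhat 𝕂 a : ∀ M : IntModule 𝕂, Module.End (RatFunc 𝕂) M.carrier) M (E 𝕂 i • v) =
      E 𝕂 i • (ofUhat 𝕂 a : ∀ M : IntModule 𝕂, Module.End (RatFunc 𝕂) M.carrier) M v := by
  rw [ofUhat_apply, ofUhat_apply]
  refine Eq.trans (finsum_congr fun m => ?_)
    (AddMonoidHom.map_finsum (DistribSMul.toAddMonoidHom M.carrier (E 𝕂 i))
      (finite_support_smul 𝕂 M a v)).symm
  obtain ⟨k, hk⟩ := exists_eq_smul_monomial (a m).2
  change _ = E 𝕂 i • (a m : U 𝕂) • v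
  rw [smul_smul, smul_smul, hk, smul_mul_assoc, mul_smul_comm, (E_commute_monomial i m).eq]

lemma F_smul_boxLowest (N : ℕ) (i : Fin 2) : F 𝕂 i • boxLowest 𝕂 N = 0 := by
  refine boxModule_ext fun x => ?_
  change (F 𝕂 i • latticeSingle (N : ℤ) 0 (1 : RatFunc 𝕂)) x = 0
  rw [ofGen_smul, latticeGen_F, latticeSingle_apply]
  split_ifs with h
  · have : x i + 1 = 0 := by simpa using congrFun h i
    rw [this, qnum_zero, zero_mul]
  · rw [mul_zero]

lemma K_smul_boxLowest (N : ℕ) (i : Fin 2) :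
    (K 𝕂 i : U 𝕂) • boxLowest 𝕂 N = q 𝕂 ^ (-N : ℤ) • boxLowest 𝕂 N := by
  refine Subtype.ext ((K_smul_latticeSingle (𝕂 := 𝕂) i 0 1).trans ?_)
  simp only [Pi.zero_apply, mul_zero, zero_sub]
  rfl

/-- This is Bᵢ𝔛v = 𝔛·bar(Bᵢ)v evaluated at x, for v the lowest weight vector. The inverse power of q
comes from Kᵢ⁻¹ in `B i`, and q^(-N) from Kᵢ acting on v in the bar conjugate. -/
lemma lowestImage_recurrence {c : Fin 2 → RatFunc 𝕂} (hc : IsParameter 𝕂 c) {a : Uhat 𝕂}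
    (ha : IsQuasiKMatrix 𝕂 c (barB hc) a) (N : ℕ) (i : Fin 2) (x : Fin 2 → ℤ) :
    qnum 𝕂 (x i + 1) * lowestImage N a (x + simpleRoot i) =
      c i * (qnum 𝕂 (N - x (tau i) + 1) * ((q 𝕂 ^ (2 * (x - simpleRoot (tau i)) i - N))⁻¹ -
        q 𝕂 ^ (-N : ℤ))) * lowestImage N a (x - simpleRoot (tau i)) := by
  have h := ha.2 ⟨B 𝕂 c i, B_mem_Bc c i⟩
  rw [coe_barB, retraction_barU_B, barU_B hc] at h
  replace h := congrArg (fun f : Ucompl 𝕂 =>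
    (f : ∀ M : IntModule 𝕂, Module.End (RatFunc 𝕂) M.carrier) (boxIntModule 𝕂 N)
      (boxLowest 𝕂 N)) h
  change B 𝕂 c i • (ofUhat 𝕂 a : ∀ M : IntModule 𝕂, Module.End (RatFunc 𝕂) M.carrier)
      (boxIntModule 𝕂 N) (boxLowest 𝕂 N) =
    (ofUhat 𝕂 a : ∀ M : IntModule 𝕂, Module.End (RatFunc 𝕂) M.carrier) (boxIntModule 𝕂 N)
      ((F 𝕂 i - c i • (E 𝕂 (tau i) * (K 𝕂 i : U 𝕂))) • boxLowest 𝕂 N) at h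
  have hE : ∀ r : RatFunc 𝕂, E 𝕂 (tau i) • r • boxLowest 𝕂 N = r • E 𝕂 (tau i) • boxLowest 𝕂 N :=
    fun r => by
      rw [← algebraMap_smul (U 𝕂) r, smul_smul, ← Algebra.commutes, mul_smul, algebraMap_smul]
  rw [sub_smul, F_smul_boxLowest, zero_sub, smul_assoc, mul_smul, K_smul_boxLowest, hE, map_neg,
    LinearMap.map_smul, LinearMap.map_smul, ofUhat_E_smul, B, sub_smul, smul_assoc, mul_smul] at h
  replace h := congrArg (boxEval 𝕂 N x) h
  rw [map_sub, map_neg, LinearMap.map_smul, LinearMap.map_smul, LinearMap.map_smul] at h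
  have eF : ∀ w : boxModule 𝕂 N, boxEval 𝕂 N x (F 𝕂 i • w) =
      qnum 𝕂 (x i + 1) * boxEval 𝕂 N (x + simpleRoot i) w := fun w =>
    congrFun (ofGen_smul (.F i) (w : LatticeFun 𝕂 N)) x
  have eE : ∀ w : boxModule 𝕂 N, boxEval 𝕂 N x (E 𝕂 (tau i) • w) =
      qnum 𝕂 (N - x (tau i) + 1) * boxEval 𝕂 N (x - simpleRoot (tau i)) w := fun w =>
    congrFun (ofGen_smul (.E (tau i)) (w : LatticeFun 𝕂 N)) x
  have eK : ∀ (w : boxModule 𝕂 N) (y : Fin 2 → ℤ),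
      boxEval 𝕂 N y (((K 𝕂 i)⁻¹ : (U 𝕂)ˣ).1 • w) =
      (q 𝕂 ^ (2 * y i - N))⁻¹ * boxEval 𝕂 N y w := fun w y =>
    congrFun (ofGen_smul (.Kinv i) (w : LatticeFun 𝕂 N)) y
  rw [eF, eE, eE, eK] at h
  simp only [smul_eq_mul] at h
  simp only [lowestImage]
  linear_combination h

lemma lowestImage_eq {c : Fin 2 → RatFunc 𝕂} (hc : IsParameter 𝕂 c) {a b : Uhat 𝕂}
    (ha : IsQuasiKMatrix 𝕂 c (barB hc) a) (hb : IsQuasiKMatrix 𝕂 c (barB hc) b) (N n : ℕ) :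
    ∀ x : Fin 2 → ℤ, x 0 + x 1 < n → lowestImage N a x = lowestImage N b x := by
  induction n with
  | zero =>
    intro x hx
    have : x 0 < 0 ∨ x 1 < 0 := by omega
    rcases this with h | h <;> rw [lowestImage_of_neg N a h, lowestImage_of_neg N b h]
  | succ n ih =>
    intro x hx
    push_cast at hx
    by_cases hneg : ∃ i, x i < 0
    · obtain ⟨i, h⟩ := hneg
      rw [lowestImage_of_neg N a h, lowestImage_of_neg N b h]
    push Not at hneg
    by_cases h0 : ∃ i, 0 < x i
    -- The recurrence at x - αᵢ expresses [xᵢ] times the value at x through the value at x - αᵢ -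
    -- α_τ(i), of height smaller by two; [xᵢ] ≠ 0 since xᵢ > 0.
    · obtain ⟨i, hi⟩ := h0
      have h1 := lowestImage_recurrence hc ha N i (x - simpleRoot i)
      have h2 := lowestImage_recurrence hc hb N i (x - simpleRoot i)
      have hlt : (x - simpleRoot i - simpleRoot (tau i)) 0 +
          (x - simpleRoot i - simpleRoot (tau i)) 1 < n := by
        fin_cases i <;> simp [tau] <;> omega
      rw [ih _ hlt, ← h2] at h1
      have e : (x - simpleRoot i) i + 1 = x i := by simp
      rw [sub_add_cancel, e] at h1
      exact mul_left_cancel₀ (qnum_ne_zero hi.ne') h1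
    · push Not at h0
      have hx0 : x = fun i => (((0 : Fin 2 → ℕ) i : ℕ) : ℤ) :=
        funext fun i => by simpa using le_antisymm (h0 i) (hneg i)
      rw [hx0, lowestImage_natCast, lowestImage_natCast, ha.1, hb.1]

lemma IsQuasiKMatrix.eq {c : Fin 2 → RatFunc 𝕂} (hc : IsParameter 𝕂 c) {a b : Uhat 𝕂}
    (ha : IsQuasiKMatrix 𝕂 c (barB hc) a) (hb : IsQuasiKMatrix 𝕂 c (barB hc) b) : a = b := by
  refine funext fun m => Subtype.ext ?_
  -- A box of size m₁ + m₂ contains the point m, so the monomial of weight m acts non-trivially on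
  -- its lowest weight vector.
  have h := lowestImage_eq hc ha hb (m 0 + m 1) (m 0 + m 1 + 1) (fun i => (m i : ℤ))
    (by push_cast; omega)
  obtain ⟨k, hk⟩ := exists_eq_smul_monomial (a m).2
  obtain ⟨l, hl⟩ := exists_eq_smul_monomial (b m).2
  obtain ⟨r, hr, hr'⟩ := monomial_smul_latticeSingle (𝕂 := 𝕂) (N := (m 0 + m 1 : ℕ)) m
  rw [lowestImage_natCast, lowestImage_natCast, hk, hl, smul_assoc, smul_assoc, hr,
    LatticeFun.smul_apply, LatticeFun.smul_apply, latticeSingle_apply, if_pos rfl] at h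
  have hr0 : r ≠ 0 := hr' fun i => by
    have hi : m i ≤ m 0 + m 1 := by fin_cases i <;> simp
    exact_mod_cast hi
  rw [hk, hl, mul_right_cancel₀ hr0 h]

end AIII11

end

open AIII11 in
theorem mainTheorem9 (𝕂 : Type u) [Field 𝕂] [CharZero 𝕂] (c : Fin 2 → RatFunc 𝕂)
    (hc : IsParameter 𝕂 c) :
    ∃ φ : Bc 𝕂 c ≃ₐ[𝕂] Bc 𝕂 c,
      (∀ ψ : Bc 𝕂 c ≃ₐ[𝕂] Bc 𝕂 c, IsBarInvolution 𝕂 c ψ ↔ ψ = φ) ∧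
      ∃ 𝔛 : Uhat 𝕂,
        (∀ 𝔜 : Uhat 𝕂, IsQuasiKMatrix 𝕂 c φ 𝔜 ↔ 𝔜 = 𝔛) ∧
        ∀ m : Fin 2 → ℕ, (𝔛 m : U 𝕂) =
          if m 0 = m 1 then
            ((q 𝕂 - (q 𝕂)⁻¹) ^ m 0 / qbraceFactorial 𝕂 (m 0) * c 0 ^ m 0) • (E 𝕂 0 * E 𝕂 1) ^ m 0
          else 0 := by
  refine ⟨barB hc, fun ψ => ⟨fun h => h.eq (isBarInvolution_barB hc), fun h => ?_⟩, quasiK (c 0),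
    fun 𝔜 => ⟨fun h => h.eq hc (isQuasiKMatrix_quasiK hc), fun h => ?_⟩, fun m => rfl⟩
  · rw [h]
    exact isBarInvolution_barB hc
  · rw [h]
    exact isQuasiKMatrix_quasiK hc
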